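/- Let $p$ be an odd prime and let $\ell$ be a prime that does not divide $p-1$. Let $D$ be a central division algebra of degree $\ell$ over $\mathbb{Q}_p$ (that is, a division algebra with centre $\mathbb{Q}_p$ and $\dim_{\mathbb{Q}_p} D=\ell^2$), and let $\mathrm{SL}_1(D)\le D^\times$ be the group of elements of reduced norm $1$, with the topology induced by the $p$-adic topology of $D$. Then: 1. $\mathrm{SL}_1(D)$ is a profinite group and a $p$-adic analytic group, i.e. it carries, for its given topology, the structure of a $p$-adic analytic manifold for which multiplication and inversion are analytic. 2. $\mathrm{SL}_1(D)$ is a CSA-group: for every $g\ne 1$ in $G=\mathrm{SL}_1(D)$ the centralizer $C=C_G(g)$ is abelian and malnormal, i.e. $C\cap hCh^{-1}=1$ for every $h\in G\smallsetminus C$. 3. $\mathrm{SL}_1(D)$ is not a pro-$p$ group. 4. $\mathrm{SL}_1(D)$ is not abelian. -/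

import Mathlib

open scoped TensorProduct Manifold ContDiff

universe u v

/-! ### Group theory -/

/-- A subgroup `H` of `G` is malnormal if every conjugate of `H` by an element outside `H`
meets `H` trivially. -/
def IsMalnormal {G : Type u} [Group G] (H : Subgroup G) : Prop :=
  ∀ g : G, g ∉ H → H ⊓ H.map (MulAut.conj g).toMonoidHom = ⊥

/-- A CA-group: the centralizer of every non-trivial element is abelian. -/
def IsCAGroup (G : Type u) [Group G] : Prop :=
  ∀ g : G, g ≠ 1 →
    ∀ x ∈ Subgroup.centralizer ({g} : Set G), ∀ y ∈ Subgroup.centralizer ({g} : Set G),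
      x * y = y * x

/-- A CSA-group: a CA-group in which the centralizer of every non-trivial element is
malnormal. -/
def IsCSAGroup (G : Type u) [Group G] : Prop :=
  IsCAGroup G ∧ ∀ g : G, g ≠ 1 → IsMalnormal (Subgroup.centralizer ({g} : Set G))

/-! ### Profinite and `p`-adic analytic groups -/

/-- A profinite group: a compact, totally disconnected (hence Hausdorff) topological group. -/
structure IsProfiniteGroup (G : Type u) [Group G] [TopologicalSpace G] : Prop where
  isTopologicalGroup : IsTopologicalGroup G
  compactSpace : CompactSpace G
  totallyDisconnectedSpace : TotallyDisconnectedSpace G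

/-- A pro-`p` group: a profinite group in which every open normal subgroup has index a power
of `p`. -/
def IsProPGroup (p : ℕ) (G : Type u) [Group G] [TopologicalSpace G] : Prop :=
  IsProfiniteGroup G ∧ ∀ N : OpenNormalSubgroup G, ∃ k : ℕ, N.toSubgroup.index = p ^ k

/-- A `p`-adic analytic group: a topological group that has, for its given topology, the
structure of a `p`-adic analytic manifold for which multiplication and inversion are analytic
(`ω` is the order of smoothness that means analytic). -/
def IsPadicAnalyticGroup (p : ℕ) [Fact p.Prime] (G : Type u) [Group G] [TopologicalSpace G] :
    Prop :=
  IsTopologicalGroup G ∧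
    ∃ (d : ℕ) (_ : ChartedSpace (Fin d → ℚ_[p]) G), LieGroup 𝓘(ℚ_[p], Fin d → ℚ_[p]) ω G

/-! ### Reduced norm and `SL₁` -/

/-- `c` is the reduced norm of the element `a` of the central simple algebra `A` over `K`:
the algebra has dimension `n ^ 2` over `K` and, under any isomorphism of its base change to an
algebraic closure of `K` with the algebra of `n × n` matrices, the image of `a` has
determinant `c`. (Such isomorphisms exist, and any two of them give the same determinant, which
lies in `K`.) -/
def HasReducedNorm (K : Type u) {A : Type v} [Field K] [Ring A] [Algebra K A] (a : A) (c : K) :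
    Prop :=
  ∀ n : ℕ, Module.finrank K A = n ^ 2 →
    ∀ φ : (AlgebraicClosure K ⊗[K] A) ≃ₐ[AlgebraicClosure K]
        Matrix (Fin n) (Fin n) (AlgebraicClosure K),
      (φ (1 ⊗ₜ[K] a)).det = algebraMap K (AlgebraicClosure K) c

/-- The reduced norm may be computed from one isomorphism with a matrix algebra. -/
theorem hasReducedNorm_iff {K : Type u} {A : Type v} [Field K] [Ring A] [Algebra K A] {n : ℕ}
    (hn : Module.finrank K A = n ^ 2)
    (φ : (AlgebraicClosure K ⊗[K] A) ≃ₐ[AlgebraicClosure K]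
      Matrix (Fin n) (Fin n) (AlgebraicClosure K)) (a : A) (c : K) :
    HasReducedNorm K a c ↔
      (φ (1 ⊗ₜ[K] a)).det = algebraMap K (AlgebraicClosure K) c := by
  refine ⟨fun h => h n hn φ, fun h m hm ψ => ?_⟩
  obtain rfl : m = n := Nat.pow_left_injective two_ne_zero (hm.symm.trans hn)
  rw [← h, ← Matrix.det_map (φ.symm.trans ψ) (φ (1 ⊗ₜ[K] a))]
  simp

/-- A central division algebra of finite dimension becomes a
matrix algebra over the algebraic closure, so that the reduced norm is a genuine condition. -/
theorem exists_splitting_algebraicClosure (K : Type u) (D : Type v) [Field K] [DivisionRing D]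
    [Algebra K D] [Algebra.IsCentral K D] [FiniteDimensional K D] :
    ∃ n : ℕ, Module.finrank K D = n ^ 2 ∧
      Nonempty ((AlgebraicClosure K ⊗[K] D) ≃ₐ[AlgebraicClosure K]
        Matrix (Fin n) (Fin n) (AlgebraicClosure K)) := by
  classical
  let L := AlgebraicClosure K
  let b := Module.Basis.ofVectorSpace K L
  let e : L ⊗[K] D ≃ₗ[K] (_ →₀ D) := TensorProduct.equivFinsuppOfBasisLeft b
  have e_tmul : ∀ (l : L) (a : D) i, e (l ⊗ₜ a) i = b.repr l i • a := fun l a i => by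
    simp [e, TensorProduct.equivFinsuppOfBasisLeft_apply_tmul]
  have e_mul : ∀ (x : L ⊗[K] D) (a : D) i, e (x * 1 ⊗ₜ a) i = e x i * a := by
    intro x a i
    induction x with
    | zero => simp
    | add x y hx hy => rw [add_mul, map_add, map_add, Finsupp.add_apply, Finsupp.add_apply, hx, hy, add_mul]
    | tmul l c => rw [Algebra.TensorProduct.tmul_mul_tmul, mul_one, e_tmul, e_tmul, smul_mul_assoc]
  have e_mul' : ∀ (x : L ⊗[K] D) (a : D) i, e (1 ⊗ₜ a * x) i = a * e x i := by
    intro x a i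
    induction x with
    | zero => simp
    | add x y hx hy => rw [mul_add, map_add, map_add, Finsupp.add_apply, Finsupp.add_apply, hx, hy, mul_add]
    | tmul l c => rw [Algebra.TensorProduct.tmul_mul_tmul, one_mul, e_tmul, e_tmul, mul_smul_comm]
  have key : ∀ (I : TwoSidedIdeal (L ⊗[K] D)) (m : ℕ) (x : L ⊗[K] D), x ∈ I → x ≠ 0 →
      (e x).support.card = m → (1 : L ⊗[K] D) ∈ I := by
    intro I m
    induction m using Nat.strong_induction_on with
    | _ m ih =>
      intro x hx hx0 hm
      obtain ⟨i₀, hi₀⟩ : (e x).support.Nonempty := by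
        rw [Finsupp.support_nonempty_iff]
        simpa using hx0
      have hc : e x i₀ ≠ 0 := by simpa using hi₀
      set y := x * 1 ⊗ₜ (e x i₀)⁻¹ with hy
      have hyI : y ∈ I := I.mul_mem_right _ _ hx
      have hy1 : e y i₀ = 1 := by rw [hy, e_mul, mul_inv_cancel₀ hc]
      have hys : (e y).support ⊆ (e x).support := by
        intro i hi
        rw [Finsupp.mem_support_iff] at hi ⊢
        intro h
        exact hi (by rw [hy, e_mul, h, zero_mul])
      by_cases hcen : ∀ a : D, 1 ⊗ₜ a * y - y * 1 ⊗ₜ a = 0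
      · have hcoef : ∀ i, ∃ k : K, e y i = algebraMap K D k := fun i => by
          rw [← Algebra.IsCentral.mem_center_iff K, Subalgebra.mem_center_iff]
          intro a
          have := congrArg (fun z => e z i) (hcen a)
          simp only [map_sub, Finsupp.sub_apply, e_mul, e_mul', map_zero, Finsupp.zero_apply] at this
          exact sub_eq_zero.mp this
        choose k hk using hcoef
        let l : L := ∑ i ∈ (e y).support, k i • b i
        have hl : y = l ⊗ₜ 1 := by
          apply e.injective
          ext i
          rw [e_tmul]
          have : b.repr l i = k i := by
            simp only [l, map_sum, map_smul, Module.Basis.repr_self, Finsupp.coe_finsetSum,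
              Finset.sum_apply, Finsupp.smul_apply, Finsupp.single_apply, smul_eq_mul, mul_ite,
              mul_one, mul_zero, Finset.sum_ite_eq']
            split_ifs with h
            · rfl
            · rw [Finsupp.notMem_support_iff, hk] at h
              exact ((map_eq_zero _).mp h).symm
          rw [this, hk, Algebra.algebraMap_eq_smul_one]
        have hl0 : l ≠ 0 := by
          rintro h
          rw [h, TensorProduct.zero_tmul] at hl
          rw [hl] at hy1
          simp at hy1
        have h1 : (l⁻¹ ⊗ₜ 1 : L ⊗[K] D) * y = 1 := by
          rw [hl, Algebra.TensorProduct.tmul_mul_tmul, inv_mul_cancel₀ hl0, one_mul,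
            Algebra.TensorProduct.one_def]
        rw [← h1]
        exact I.mul_mem_left _ _ hyI
      · push Not at hcen
        obtain ⟨a, ha⟩ := hcen
        refine ih _ ?_ _ (I.sub_mem (I.mul_mem_left _ _ hyI) (I.mul_mem_right _ _ hyI)) ha rfl
        rw [← hm]
        apply Finset.card_lt_card
        refine ⟨fun i hi => hys ?_, fun h => ?_⟩
        · rw [Finsupp.mem_support_iff, map_sub, Finsupp.sub_apply, e_mul, e_mul'] at hi
          rw [Finsupp.mem_support_iff]
          intro h
          simp [h] at hi
        · have := h hi₀
          rw [Finsupp.mem_support_iff, map_sub, Finsupp.sub_apply, e_mul, e_mul', hy1] at this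
          simp at this
  have : Nontrivial (L ⊗[K] D) := 
    (Algebra.TensorProduct.includeRight_injective (algebraMap K L).injective : Function.Injective
      (Algebra.TensorProduct.includeRight : D →ₐ[K] L ⊗[K] D)).nontrivial
  have : IsSimpleRing (L ⊗[K] D) := by
    refine ⟨⟨fun I => ?_⟩⟩
    by_cases h : ∃ x ∈ I, x ≠ 0
    · obtain ⟨x, hx, hx0⟩ := h
      exact Or.inr (I.one_mem_iff.mp (key I _ x hx hx0 rfl))
    · push Not at h
      refine Or.inl (le_bot_iff.mp fun x hx => ?_)
      rw [h x hx]
      exact zero_mem _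
  obtain ⟨n, _, ⟨φ⟩⟩ := IsSimpleRing.exists_algEquiv_matrix_of_isAlgClosed L (L ⊗[K] D)
  refine ⟨n, ?_, ⟨φ⟩⟩
  have h := φ.toLinearEquiv.finrank_eq
  rw [Module.finrank_baseChange, Module.finrank_matrix] at h
  simpa [sq] using h

/-- `SL₁(A)`: the group of units of reduced norm `1` in a central simple algebra `A`. -/
def SLOne (K : Type u) (A : Type v) [Field K] [Ring A] [Algebra K A] : Subgroup Aˣ where
  carrier := {x | HasReducedNorm K (x : A) 1}
  one_mem' := by
    intro n _ φ
    rw [Units.val_one, ← Algebra.TensorProduct.one_def, map_one, Matrix.det_one, map_one]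
  mul_mem' := by
    intro x y hx hy n hn φ
    have h : (1 : AlgebraicClosure K) ⊗ₜ[K] ((x * y : Aˣ) : A)
        = (1 ⊗ₜ[K] (x : A)) * (1 ⊗ₜ[K] (y : A)) := by
      rw [Algebra.TensorProduct.tmul_mul_tmul, one_mul, Units.val_mul]
    rw [h, map_mul, Matrix.det_mul, hx n hn φ, hy n hn φ, ← map_mul, one_mul]
  inv_mem' := by
    intro x hx n hn φ
    have h : ((1 : AlgebraicClosure K) ⊗ₜ[K] (x : A)) * (1 ⊗ₜ[K] ((x⁻¹ : Aˣ) : A)) = 1 := by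
      rw [Algebra.TensorProduct.tmul_mul_tmul, one_mul, Units.mul_inv,
        Algebra.TensorProduct.one_def]
    have h2 := congrArg (fun z => (φ z).det) h
    simp only [map_mul, Matrix.det_mul, map_one, Matrix.det_one, hx n hn φ, one_mul] at h2
    rw [h2, map_one]

/-! ### Roots of unity in `ℚ_[p]` -/

/-! Since `ℓ ∤ p - 1` and `p` is odd, `ℚ_[p]` has no `ℓ`-th root of unity except `1`. The regular
norm of `D` is the `ℓ`-th power of the reduced norm, so reduced norm `1` means regular norm `1`
(`mem_SLOne_iff_norm_eq_one`). The same fact makes `1` the only central element of the group.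

Topology: a root of the absolute value of the regular norm is an ultrametric absolute value on `D`
inducing the module topology. The group is closed in `D` and bounded, hence profinite. The norm is a
submersion at `1`, so its fibre through `1` is a manifold, with charts moved around by translation.

CSA: as `ℓ` is prime, a subalgebra other than `⊥` and `⊤` has dimension `ℓ`. So a non-central `x`
has centralizer `K[x]`, and commuting is transitive on non-central elements. For malnormality
(`commute_of_commute_conj`), let `x = h y h⁻¹` commute with `y`. Conjugation by `h` preserves the
field `K[x]`, where the minimal polynomial of `x` has at most `ℓ` roots, so `h ^ m` commutes with
`x` for some `0 < m ≤ ℓ`. If `h ^ m` is not central, `h` commutes with `x` by transitivity; if it is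
central it equals `1`, which a non-central `h` of degree `ℓ` cannot satisfy.

Not pro-`p`: `D` is not generated by one element, so its residue ring is larger than that of
`ℚ_[p]`. A Teichmüller lift `w` of a new residue gives `w ^ (p - 1) ≠ 1`, of norm `1` and finite
order prime to `p`. Non-commutativity is the Cartan–Brauer–Hua argument applied to a commutator. -/

theorem eq_one_of_pow_eq_one_of_norm_sub_one_lt {p : ℕ} [Fact p.Prime] {m : ℕ} {z : ℤ_[p]}
    (hz : ‖z - 1‖ < 1) (hm : ¬ p ∣ m) (h : z ^ m = 1) : z = 1 := by
  have h0 : PadicInt.toZMod z = 1 := by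
    rw [← sub_eq_zero, ← map_one PadicInt.toZMod, ← map_sub, ← RingHom.mem_ker,
      PadicInt.ker_toZMod, PadicInt.maximalIdeal_eq_span_p]
    exact (PadicInt.norm_lt_one_iff_dvd _).mp hz |> Ideal.mem_span_singleton.mpr
  have h1 : (∑ i ∈ Finset.range m, z ^ i) * (z - 1) = 0 := by
    rw [geom_sum_mul, h, sub_self]
  -- The geometric sum reduces to `m` modulo `p`, so it cannot vanish.
  rcases mul_eq_zero.mp h1 with h2 | h2
  · have := congrArg PadicInt.toZMod h2
    simp only [map_sum, map_pow, h0, one_pow, Finset.sum_const, Finset.card_range, nsmul_eq_mul,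
      mul_one, map_zero] at this
    exact absurd ((ZMod.natCast_eq_zero_iff _ _).mp this) hm
  · exact sub_eq_zero.mp h2

/-- Here the geometric sum vanishes modulo `p`, but for odd `p` it is `p` modulo `p ^ 2`, hence
non-zero. For `p = 2` the root `-1` is a counterexample. -/
theorem eq_one_of_pow_prime_eq_one_of_norm_sub_one_lt {p : ℕ} [Fact p.Prime] (hp : Odd p)
    {z : ℤ_[p]} (hz : ‖z - 1‖ < 1) (h : z ^ p = 1) : z = 1 := by
  obtain ⟨b, hb⟩ := (PadicInt.norm_lt_one_iff_dvd _).mp hz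
  have h1 : (∑ i ∈ Finset.range p, z ^ i) * (z - 1) = 0 := by
    rw [geom_sum_mul, h, sub_self]
  rcases mul_eq_zero.mp h1 with h2 | h2
  · have h3 := odd_sq_dvd_geom_sum₂_sub (R := ℤ_[p]) (a := 1) (b := b) hp
    simp only [one_pow, mul_one, ← hb, add_sub_cancel, h2, zero_sub, dvd_neg] at h3
    have hp0 : (p : ℤ_[p]) ≠ 0 := Nat.cast_ne_zero.mpr (Fact.out : p.Prime).ne_zero
    obtain ⟨c, hc⟩ := h3
    have h4 : (p : ℤ_[p]) * c = 1 := by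
      apply mul_left_cancel₀ hp0
      rw [mul_one, ← mul_assoc, ← sq, ← hc]
    exact absurd (IsUnit.of_mul_eq_one _ h4) PadicInt.prime_p.not_isUnit
  · exact sub_eq_zero.mp h2

/-- The order of the residue of `z` divides both `m` and `p - 1`. -/
theorem PadicInt.norm_sub_one_lt_of_pow_eq_one {p : ℕ} [Fact p.Prime] {m : ℕ} (hm0 : m ≠ 0)
    (hm : m.Coprime (p - 1)) {z : ℤ_[p]} (h : z ^ m = 1) : ‖z - 1‖ < 1 := by
  rw [PadicInt.norm_lt_one_iff_dvd, ← Ideal.mem_span_singleton, ← PadicInt.maximalIdeal_eq_span_p,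
    ← PadicInt.ker_toZMod, RingHom.mem_ker, map_sub, map_one, sub_eq_zero]
  have h1 : PadicInt.toZMod z ^ m = 1 := by rw [← map_pow, h, map_one]
  have h2 := ZMod.pow_card_sub_one_eq_one (IsUnit.of_pow_eq_one h1 hm0).ne_zero
  rw [← orderOf_eq_one_iff]
  exact Nat.eq_one_of_dvd_coprimes hm (orderOf_dvd_of_pow_eq_one h1) (orderOf_dvd_of_pow_eq_one h2)

theorem Padic.eq_one_of_pow_prime_eq_one {p : ℕ} [Fact p.Prime] (hp : Odd p) {ℓ : ℕ}
    (hℓ : ℓ.Prime) (hℓp : ¬ ℓ ∣ p - 1) {z : ℚ_[p]} (h : z ^ ℓ = 1) : z = 1 := by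
  have hn : ‖z‖ = 1 := by
    have := congrArg norm h
    rw [norm_pow, norm_one] at this
    exact (pow_eq_one_iff_of_nonneg (norm_nonneg _) hℓ.ne_zero).mp this
  obtain ⟨z, rfl⟩ : ∃ y : ℤ_[p], (y : ℚ_[p]) = z := ⟨⟨z, hn.le⟩, rfl⟩
  have h : z ^ ℓ = 1 := Subtype.ext (by simpa using h)
  suffices z = 1 by rw [this, PadicInt.coe_one]
  have h1 := PadicInt.norm_sub_one_lt_of_pow_eq_one hℓ.ne_zero ((hℓ.coprime_iff_not_dvd).mpr hℓp) h
  by_cases hpl : p ∣ ℓ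
  · obtain rfl := (Nat.prime_dvd_prime_iff_eq Fact.out hℓ).mp hpl
    exact eq_one_of_pow_prime_eq_one_of_norm_sub_one_lt hp h1 h
  · exact eq_one_of_pow_eq_one_of_norm_sub_one_lt h1 hpl h

/-! ### Subalgebras of a central division algebra of prime degree -/

section DivisionAlgebra

variable {K : Type u} {D : Type v} [Field K] [DivisionRing D] [Algebra K D]

/-- A subalgebra of a finite-dimensional division algebra is itself a division ring, so `D` is free
over it and dimensions multiply. -/
theorem Subalgebra.finrank_dvd_finrank [FiniteDimensional K D] (S : Subalgebra K D) :
    Module.finrank K S ∣ Module.finrank K D := by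
  have hS : ∀ a : S, IsUnit a ∨ a = 0 := fun a => by
    by_cases ha : a = 0
    · exact Or.inr ha
    · left
      have hinj : Function.Injective (LinearMap.mulLeft K a) := fun x y hxy => by
        simp only [LinearMap.mulLeft_apply] at hxy
        exact mul_left_cancel₀ ha hxy
      obtain ⟨b, hb⟩ := LinearMap.surjective_of_injective hinj 1
      exact IsUnit.of_mul_eq_one _ hb
  let _ : DivisionRing S := DivisionRing.ofIsUnitOrEqZero hS
  exact Dvd.intro _ (Module.finrank_mul_finrank K S D)

variable {ℓ : ℕ}

theorem mem_bot_of_centralizer_eq_top [Algebra.IsCentral K D] {x : D}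
    (hx : Subalgebra.centralizer K {x} = ⊤) : x ∈ (⊥ : Subalgebra K D) := by
  rw [← Algebra.IsCentral.center_eq_bot K D, Subalgebra.mem_center_iff]
  intro b
  have : b ∈ Subalgebra.centralizer K {x} := hx ▸ Algebra.mem_top
  exact ((Subalgebra.mem_centralizer_iff K).mp this x rfl).symm

theorem adjoin_le_centralizer (x : D) :
    Algebra.adjoin K {x} ≤ Subalgebra.centralizer K {x} := by
  rw [Algebra.adjoin_le_iff, Set.singleton_subset_iff]
  exact (Subalgebra.mem_centralizer_iff K).mpr (by simp)

theorem finrank_eq_of_ne_bot_of_ne_top (hℓ : ℓ.Prime) (hD : Module.finrank K D = ℓ ^ 2)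
    {S : Subalgebra K D} (h1 : S ≠ ⊥) (h2 : S ≠ ⊤) : Module.finrank K S = ℓ := by
  have : FiniteDimensional K D :=
    Module.finite_of_finrank_pos (hD ▸ pow_pos hℓ.pos 2)
  obtain ⟨k, hk, hS⟩ := (Nat.dvd_prime_pow hℓ).mp (hD ▸ S.finrank_dvd_finrank)
  interval_cases k
  · exact absurd (Subalgebra.eq_bot_of_finrank_one (by simpa using hS)) h1
  · simpa using hS
  · exact absurd (Algebra.toSubmodule_eq_top.mp
      (Submodule.eq_top_of_finrank_eq (by rw [hD]; exact hS))) h2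

variable [Algebra.IsCentral K D] (hℓ : ℓ.Prime) (hD : Module.finrank K D = ℓ ^ 2)
include hℓ hD

theorem finrank_centralizer {x : D} (hx : x ∉ (⊥ : Subalgebra K D)) :
    Module.finrank K (Subalgebra.centralizer K {x}) = ℓ :=
  finrank_eq_of_ne_bot_of_ne_top hℓ hD
    (fun h => hx (h ▸ adjoin_le_centralizer x (Algebra.self_mem_adjoin_singleton K x)))
    (fun h => hx (mem_bot_of_centralizer_eq_top h))

theorem centralizer_eq_adjoin {x : D} (hx : x ∉ (⊥ : Subalgebra K D)) :
    Subalgebra.centralizer K {x} = Algebra.adjoin K {x} := by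
  have : FiniteDimensional K D :=
    Module.finite_of_finrank_pos (hD ▸ pow_pos hℓ.pos 2)
  symm
  apply Subalgebra.eq_of_le_of_finrank_eq (adjoin_le_centralizer x)
  rw [finrank_centralizer hℓ hD hx]
  refine finrank_eq_of_ne_bot_of_ne_top hℓ hD
    (fun h => hx (h ▸ (Algebra.self_mem_adjoin_singleton K x))) (fun h => hx ?_)
  exact mem_bot_of_centralizer_eq_top (top_le_iff.mp (h ▸ adjoin_le_centralizer x))

theorem centralizer_eq_of_commute {x y : D} (hx : x ∉ (⊥ : Subalgebra K D))
    (hy : y ∉ (⊥ : Subalgebra K D)) (h : Commute x y) :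
    Subalgebra.centralizer K {x} = Subalgebra.centralizer K {y} := by
  have : FiniteDimensional K D :=
    Module.finite_of_finrank_pos (hD ▸ pow_pos hℓ.pos 2)
  apply Subalgebra.eq_of_le_of_finrank_eq
  · rw [centralizer_eq_adjoin hℓ hD hx, Algebra.adjoin_le_iff, Set.singleton_subset_iff]
    exact (Subalgebra.mem_centralizer_iff K).mpr (by simpa using h.symm.eq)
  · rw [finrank_centralizer hℓ hD hx, finrank_centralizer hℓ hD hy]

/-- Commuting non-central elements have equal centralizers, by inclusion and equality of dimensions.
This is the source of the CA property. -/
theorem commute_of_commute_of_commute {x y z : D} (hx : x ∉ (⊥ : Subalgebra K D))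
    (hy : Commute x y) (hz : Commute x z) : Commute y z := by
  by_cases hy' : y ∈ (⊥ : Subalgebra K D)
  · obtain ⟨c, rfl⟩ := Algebra.mem_bot.mp hy'
    exact Algebra.commutes c z
  · have hz' : z ∈ Subalgebra.centralizer K {x} :=
      (Subalgebra.mem_centralizer_iff K).mpr (by simpa using hz.eq)
    rw [centralizer_eq_of_commute hℓ hD hx hy' hy] at hz'
    exact (Subalgebra.mem_centralizer_iff K).mp hz' y rfl

theorem natDegree_minpoly_eq {x : D} (hx : x ∉ (⊥ : Subalgebra K D)) :
    (minpoly K x).natDegree = ℓ := by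
  have : FiniteDimensional K D :=
    Module.finite_of_finrank_pos (hD ▸ pow_pos hℓ.pos 2)
  have hli := linearIndependent_pow (K := K) x
  have hspan : Subalgebra.toSubmodule (Algebra.adjoin K {x}) =
      Submodule.span K (Set.range fun i : Fin (minpoly K x).natDegree => x ^ (i : ℕ)) := by
    apply le_antisymm
    · intro y hy
      rw [Subalgebra.mem_toSubmodule, Algebra.adjoin_singleton_eq_range_aeval] at hy
      obtain ⟨f, rfl⟩ := hy
      exact (Algebra.IsIntegral.isIntegral x).mem_span_pow ⟨f, rfl⟩
    · rw [Submodule.span_le]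
      rintro _ ⟨i, rfl⟩
      exact pow_mem (Algebra.self_mem_adjoin_singleton K x) _
  rw [← finrank_centralizer hℓ hD hx, centralizer_eq_adjoin hℓ hD hx,
    ← Subalgebra.finrank_toSubmodule, hspan, finrank_span_eq_card hli, Fintype.card_fin]

end DivisionAlgebra

/-! ### The reduced norm and the regular norm -/

/-- Left multiplication by `M` on matrices is `M ⊗ 1`: one copy of `M` for each column. -/
theorem Matrix.algebraNorm_eq_det_pow {L : Type*} [Field L] {n : Type*} [Fintype n] [DecidableEq n]
    (M : Matrix n n L) : Algebra.norm L M = M.det ^ Fintype.card n := by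
  have h : Algebra.leftMulMatrix (Matrix.stdBasis L n n) M =
      Matrix.kroneckerMap (· * ·) M (1 : Matrix n n L) := by
    ext ⟨i, j⟩ ⟨k, l⟩
    rw [Algebra.leftMulMatrix_eq_repr_mul, Matrix.stdBasis_eq_single, Matrix.kroneckerMap_apply]
    change (M * Matrix.single k l (1 : L)) i j = _
    by_cases hjl : j = l
    · subst hjl
      simp
    · rw [Matrix.mul_single_apply_of_ne _ _ _ _ _ hjl, Matrix.one_apply_ne hjl, mul_zero]
  rw [Algebra.norm_eq_matrix_det (Matrix.stdBasis L n n), h, Matrix.det_kronecker, Matrix.det_one,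
    one_pow, mul_one]

theorem LinearIndependent.one_tmul {K V ι : Type*} [Field K] [AddCommGroup V] [Module K V]
    {v : ι → V} (hv : LinearIndependent K v) (L : Type*) [Field L] [Algebra K L] :
    LinearIndependent L fun i => (1 ⊗ₜ[K] v i : L ⊗[K] V) := by
  let b := Module.Basis.extend hv.linearIndepOn_id
  let j : ι → hv.linearIndepOn_id.extend (Set.subset_univ (Set.range v)) := fun i =>
    ⟨v i, hv.linearIndepOn_id.subset_extend _ ⟨i, rfl⟩⟩
  have hj : Function.Injective j := fun i i' h => hv.injective (congrArg Subtype.val h)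
  convert (Algebra.TensorProduct.basis L b).linearIndependent.comp j hj using 2 with i
  simp [b, j]

section ReducedNorm

variable {K : Type u} {D : Type v} [Field K] [DivisionRing D] [Algebra K D]
  [FiniteDimensional K D]

theorem Algebra.norm_one_tmul (L : Type*) [Field L] [Algebra K L] (x : D) :
    Algebra.norm L (1 ⊗ₜ[K] x : L ⊗[K] D) = algebraMap K L (Algebra.norm K x) := by
  rw [Algebra.norm_apply, Algebra.norm_apply, ← LinearMap.det_baseChange]
  congr 1
  ext y
  simp

variable {ℓ : ℕ} [Algebra.IsCentral K D] (hℓ : ℓ.Prime) (hD : Module.finrank K D = ℓ ^ 2)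
include hℓ hD

open Polynomial in
-- The first `ℓ` powers of `x` stay independent after base change, so no non-zero polynomial of
-- degree below `ℓ` kills the matrix. Both sides are monic of degree `ℓ` and kill it, so their
-- difference is zero.
theorem charpoly_eq_map_minpoly {L : Type*} [Field L] [Algebra K L]
    (φ : (L ⊗[K] D) ≃ₐ[L] Matrix (Fin ℓ) (Fin ℓ) L) {x : D} (hx : x ∉ (⊥ : Subalgebra K D)) :
    (φ (1 ⊗ₜ x)).charpoly = (minpoly K x).map (algebraMap K L) := by
  have hdeg := natDegree_minpoly_eq hℓ hD hx
  have hint : IsIntegral K x := Algebra.IsIntegral.isIntegral x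
  have hmon := (minpoly.monic hint).map (algebraMap K L)
  set M := φ (1 ⊗ₜ x) with hM
  have hroot : aeval M ((minpoly K x).map (algebraMap K L)) = 0 := by
    rw [aeval_map_algebraMap]
    have : M = (φ.toAlgHom.restrictScalars K |>.comp
      (Algebra.TensorProduct.includeRight : D →ₐ[K] L ⊗[K] D)) x := rfl
    rw [this, aeval_algHom_apply, minpoly.aeval, map_zero]
  have hli : LinearIndependent L fun i : Fin ℓ => M ^ (i : ℕ) := by
    have h1 := linearIndependent_pow (K := K) x
    rw [hdeg] at h1
    have h2 := (h1.one_tmul L).map' φ.toLinearMap (LinearMap.ker_eq_bot.mpr φ.injective)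
    have h3 : (fun i : Fin ℓ => M ^ (i : ℕ)) =
        φ.toLinearMap ∘ fun i : Fin ℓ => (1 ⊗ₜ[K] (x ^ (i : ℕ)) : L ⊗[K] D) := by
      ext1 i
      simp [hM, ← map_pow]
    rw [h3]
    exact h2
  have hrel : ∀ q : L[X], q.degree < ℓ → aeval M q = 0 → q = 0 := by
    intro q hq h0
    by_contra hq0
    rw [aeval_eq_sum_range' ((natDegree_lt_iff_degree_lt hq0).mpr hq), Finset.sum_range] at h0
    have := Fintype.linearIndependent_iff.mp hli _ h0
    refine hq0 (ext fun i => ?_)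
    by_cases hi : i < ℓ
    · simpa using this ⟨i, hi⟩
    · rw [coeff_zero]
      exact coeff_eq_zero_of_degree_lt (hq.trans_le (by exact_mod_cast not_lt.mp hi))
  rw [← sub_eq_zero]
  apply hrel
  · have h1 : M.charpoly.degree = ℓ := by simp [Matrix.charpoly_degree_eq_dim]
    rw [← h1]
    apply degree_sub_lt_left _ (Matrix.charpoly_monic M).ne_zero
    · rw [(Matrix.charpoly_monic M).leadingCoeff, hmon.leadingCoeff]
    · rw [h1, degree_map, degree_eq_natDegree (minpoly.ne_zero hint), hdeg]
  · rw [map_sub, hroot, sub_zero, Matrix.aeval_self_charpoly]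

/-- Descent of the determinant to `K` is needed because the hypothesis on roots of unity concerns
`K` only, not its closure. -/
theorem exists_det_eq_algebraMap {L : Type*} [Field L] [Algebra K L]
    (φ : (L ⊗[K] D) ≃ₐ[L] Matrix (Fin ℓ) (Fin ℓ) L) (x : D) :
    ∃ c : K, (φ (1 ⊗ₜ x)).det = algebraMap K L c := by
  by_cases hx : x ∈ (⊥ : Subalgebra K D)
  · obtain ⟨c, rfl⟩ := Algebra.mem_bot.mp hx
    refine ⟨c ^ ℓ, ?_⟩
    have : (1 ⊗ₜ[K] algebraMap K D c : L ⊗[K] D) = algebraMap L _ (algebraMap K L c) := by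
      rw [Algebra.algebraMap_eq_smul_one, ← TensorProduct.smul_tmul,
        Algebra.TensorProduct.algebraMap_apply, Algebra.algebraMap_eq_smul_one c,
        Algebra.algebraMap_self_apply]
    rw [this, AlgEquiv.commutes, Matrix.algebraMap_eq_diagonal, Matrix.det_diagonal]
    simp
  · refine ⟨(-1) ^ ℓ * (minpoly K x).coeff 0, ?_⟩
    rw [Matrix.det_eq_sign_charpoly_coeff, charpoly_eq_map_minpoly hℓ hD φ hx]
    simp

/-- If `1` is the only `ℓ`-th root of unity of `K`, the elements of reduced norm `1` are those
of norm `1`. -/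
theorem mem_SLOne_iff_norm_eq_one (hK : ∀ c : K, c ^ ℓ = 1 → c = 1) (x : Dˣ) :
    x ∈ SLOne K D ↔ Algebra.norm K (x : D) = 1 := by
  obtain ⟨n, hn, ⟨φ⟩⟩ := exists_splitting_algebraicClosure K D
  obtain rfl : n = ℓ := Nat.pow_left_injective two_ne_zero (hn.symm.trans hD)
  change HasReducedNorm K (x : D) 1 ↔ _
  rw [hasReducedNorm_iff hD φ, map_one]
  obtain ⟨c, hc⟩ := exists_det_eq_algebraMap hℓ hD φ (x : D)
  have hdet : Algebra.norm K (x : D) = c ^ n := by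
    apply (algebraMap K (AlgebraicClosure K)).injective
    rw [← Algebra.norm_one_tmul, ← Algebra.norm_eq_of_algEquiv φ, Matrix.algebraNorm_eq_det_pow,
      hc, map_pow, Fintype.card_fin]
  rw [hdet, hc, map_eq_one_iff _ (algebraMap K (AlgebraicClosure K)).injective]
  exact ⟨fun h => by rw [h, one_pow], hK c⟩

end ReducedNorm

/-! ### The absolute value of a division algebra over a local field -/

theorem NormedAlgebra.eq_moduleTopology_of_finite (K : Type u) (D : Type v)
    [NontriviallyNormedField K] [NormedDivisionRing D] [NormedAlgebra K D] [CompleteSpace K]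
    [FiniteDimensional K D] :
    (inferInstance : TopologicalSpace D) = moduleTopology K D :=
  (isModuleTopologyOfFiniteDimensional (𝕜 := K) (E := D)).eq_moduleTopology'

section AbsoluteValue

variable (K : Type u) (D : Type v) [NontriviallyNormedField K]
  [divRing : DivisionRing D] [alg : Algebra K D] [FiniteDimensional K D]

/-- The regular norm in coordinates. -/
noncomputable def coordNorm (v : Fin (Module.finrank K D) → K) : K :=
  Algebra.norm K ((Module.finBasis K D).equivFun.symm v)

theorem continuous_coordNorm [CompleteSpace K] : Continuous (coordNorm K D) := by
  have h : coordNorm K D = fun v => (((Algebra.leftMulMatrix (Module.finBasis K D)).toLinearMap ∘ₗ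
      (Module.finBasis K D).equivFun.symm.toLinearMap) v).det := by
    ext v
    exact Algebra.norm_eq_matrix_det (Module.finBasis K D) _
  rw [h]
  exact (LinearMap.continuous_of_finiteDimensional _).matrix_det

theorem norm_coordNorm_smul (t : K) (v : Fin (Module.finrank K D) → K) :
    ‖coordNorm K D (t • v)‖ = ‖t‖ ^ Module.finrank K D * ‖coordNorm K D v‖ := by
  rw [coordNorm, coordNorm, map_smul, Algebra.smul_def, map_mul, Algebra.norm_algebraMap, norm_mul,
    norm_pow]

theorem exists_smul_norm_eq_one {ι : Type*} [Fintype ι] {v : ι → K} (hv : v ≠ 0) :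
    ∃ (t : K) (w : ι → K), v = t • w ∧ ‖w‖ = 1 ∧ ‖t‖ = ‖v‖ := by
  have hne : Nonempty ι := by
    by_contra h
    rw [not_nonempty_iff] at h
    exact hv (Subsingleton.elim _ _)
  obtain ⟨i, hi⟩ : ∃ i, ‖v i‖ = ‖v‖ := by
    obtain ⟨i, -, hi⟩ := Finset.exists_mem_eq_sup Finset.univ Finset.univ_nonempty (fun i => ‖v i‖₊)
    exact ⟨i, by rw [Pi.norm_def, hi, coe_nnnorm]⟩
  have hvi : v i ≠ 0 := norm_ne_zero_iff.mp (hi ▸ norm_ne_zero_iff.mpr hv)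
  refine ⟨v i, (v i)⁻¹ • v, by rw [smul_smul, mul_inv_cancel₀ hvi, one_smul], ?_, hi⟩
  rw [norm_smul, norm_inv, hi, inv_mul_cancel₀ (norm_ne_zero_iff.mpr hv)]

/-- On the compact unit sphere the norm form is continuous and has no zero, since `D` is a division
ring; homogeneity does the rest. -/
theorem exists_norm_coordNorm_bounds [ProperSpace K] :
    ∃ c C : ℝ, 0 < c ∧ 0 < C ∧ ∀ v, c * ‖v‖ ^ Module.finrank K D ≤ ‖coordNorm K D v‖ ∧
      ‖coordNorm K D v‖ ≤ C * ‖v‖ ^ Module.finrank K D := by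
  have hd : 0 < Module.finrank K D := Module.finrank_pos
  have hcont : Continuous fun v => ‖coordNorm K D v‖ := (continuous_coordNorm K D).norm
  have hS := isCompact_sphere (0 : Fin (Module.finrank K D) → K) 1
  have hne : (Metric.sphere (0 : Fin (Module.finrank K D) → K) 1).Nonempty := by
    refine ⟨fun _ => 1, ?_⟩
    have : Nonempty (Fin (Module.finrank K D)) := ⟨⟨0, hd⟩⟩
    rw [mem_sphere_zero_iff_norm, pi_norm_const, norm_one]
  obtain ⟨v₀, hv₀, hmin⟩ := hS.exists_isMinOn hne hcont.continuousOn
  obtain ⟨v₁, hv₁, hmax⟩ := hS.exists_isMaxOn hne hcont.continuousOn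
  rw [isMinOn_iff] at hmin
  rw [isMaxOn_iff] at hmax
  have hpos : ∀ v ∈ Metric.sphere (0 : Fin (Module.finrank K D) → K) 1,
      0 < ‖coordNorm K D v‖ := by
    intro v hv
    rw [norm_pos_iff, coordNorm, Algebra.norm_ne_zero_iff, Ne, LinearEquiv.map_eq_zero_iff]
    rintro rfl
    simp at hv
  refine ⟨_, _, hpos v₀ hv₀, hpos v₁ hv₁, fun v => ?_⟩
  by_cases hv : v = 0
  · subst hv
    simp [coordNorm, hd.ne']
  obtain ⟨t, w, hvw, hw, ht⟩ := exists_smul_norm_eq_one K hv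
  have hw' : w ∈ Metric.sphere (0 : Fin (Module.finrank K D) → K) 1 := by simpa using hw
  have h1 : ‖coordNorm K D v‖ = ‖v‖ ^ Module.finrank K D * ‖coordNorm K D w‖ := by
    rw [← ht, ← norm_coordNorm_smul, ← hvw]
  rw [h1, mul_comm _ (‖coordNorm K D w‖)]
  exact ⟨by gcongr; exact hmin w hw', by gcongr; exact hmax w hw'⟩

variable {D}

/-- The power trick: the coordinates of `(1 + x) ^ n` are bounded independently of `n`, so the
powers of `‖N(1 + x)‖` are bounded. -/
theorem norm_algebraNorm_one_add_le_one [ProperSpace K] [IsUltrametricDist K] {x : D}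
    (hx : ‖Algebra.norm K x‖ ≤ 1) : ‖Algebra.norm K (1 + x)‖ ≤ 1 := by
  obtain ⟨c, C, hc, hC, h⟩ := exists_norm_coordNorm_bounds K D
  have hd : Module.finrank K D ≠ 0 := (Module.finrank_pos).ne'
  set e := (Module.finBasis K D).equivFun with he
  have hN : ∀ y : D, coordNorm K D (e y) = Algebra.norm K y := fun y => by
    rw [coordNorm, ← he, LinearEquiv.symm_apply_apply]
  obtain ⟨R, hR0, hR⟩ : ∃ R : ℝ, 0 ≤ R ∧ ∀ y : D, ‖Algebra.norm K y‖ ≤ 1 → ‖e y‖ ≤ R := by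
    -- Beyond this radius the lower bound `c * ‖v‖ ^ d ≥ c * ‖v‖` exceeds `1`.
    refine ⟨max 1 c⁻¹, by positivity, fun y hy => ?_⟩
    by_contra! hlt
    have h1 := (h (e y)).1
    rw [hN] at h1
    have h2 : ‖e y‖ ≤ ‖e y‖ ^ Module.finrank K D :=
      le_self_pow₀ ((le_max_left _ _).trans hlt.le) hd
    have h3 : 1 < c * ‖e y‖ := by
      rw [← inv_lt_iff_one_lt_mul₀' hc]
      exact (le_max_right _ _).trans_lt hlt
    have h4 : c * ‖e y‖ ≤ c * ‖e y‖ ^ Module.finrank K D := by gcongr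
    linarith
  have hpow : ∀ n : ℕ, ‖Algebra.norm K (1 + x)‖ ^ n ≤ C * R ^ Module.finrank K D := by
    intro n
    have h1 : ‖e ((1 + x) ^ n)‖ ≤ R := by
      rw [add_comm, (Commute.one_right x).add_pow, map_sum]
      refine IsUltrametricDist.norm_sum_le_of_forall_le_of_nonneg hR0 fun i _ => ?_
      have h2 : x ^ i * 1 ^ (n - i) * (n.choose i : D) = (n.choose i : K) • x ^ i := by
        rw [one_pow, mul_one, Algebra.smul_def, map_natCast, (Nat.cast_commute _ _).eq]
      rw [h2, map_smul, norm_smul]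
      have h3 : ‖e (x ^ i)‖ ≤ R := by
        apply hR
        rw [map_pow, norm_pow]
        exact pow_le_one₀ (norm_nonneg _) hx
      calc ‖(n.choose i : K)‖ * ‖e (x ^ i)‖ ≤ 1 * R := by
            gcongr
            exact IsUltrametricDist.norm_natCast_le_one K _
        _ = R := one_mul R
    rw [← norm_pow, ← map_pow, ← hN]
    exact (h _).2.trans (by gcongr)
  by_contra! hlt
  obtain ⟨n, hn⟩ := pow_unbounded_of_one_lt (C * R ^ Module.finrank K D) hlt
  exact absurd (hpow n) hn.not_ge

theorem norm_algebraNorm_add_le_max [ProperSpace K] [IsUltrametricDist K] (x y : D) :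
    ‖Algebra.norm K (x + y)‖ ≤ max ‖Algebra.norm K x‖ ‖Algebra.norm K y‖ := by
  wlog hxy : ‖Algebra.norm K y‖ ≤ ‖Algebra.norm K x‖ generalizing x y
  · rw [add_comm, max_comm]
    exact this y x (not_le.mp hxy).le
  by_cases hx : x = 0
  · subst hx
    simp
  · have hx' : 0 < ‖Algebra.norm K x‖ := norm_pos_iff.mpr (Algebra.norm_ne_zero_iff.mpr hx)
    have h1 : x + y = x * (1 + x⁻¹ * y) := by
      rw [mul_add, mul_one, ← mul_assoc, mul_inv_cancel₀ hx, one_mul]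
    have h2 : ‖Algebra.norm K (x⁻¹ * y)‖ ≤ 1 := by
      rw [map_mul, Algebra.norm_inv, norm_mul, norm_inv, inv_mul_le_iff₀ hx', mul_one]
      exact hxy
    rw [h1, map_mul, norm_mul]
    exact (mul_le_of_le_one_right (norm_nonneg _) (norm_algebraNorm_one_add_le_one K h2)).trans
      (le_max_left _ _)

/-- The absolute value of a finite dimensional division algebra over a local field. -/
noncomputable def divAbs (x : D) : ℝ :=
  ‖Algebra.norm K x‖ ^ ((Module.finrank K D : ℝ)⁻¹)

omit [FiniteDimensional K D] in
theorem divAbs_nonneg (x : D) : 0 ≤ divAbs K x := Real.rpow_nonneg (norm_nonneg _) _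

theorem divAbs_zero : divAbs K (0 : D) = 0 := by
  rw [divAbs, Algebra.norm_zero, norm_zero, Real.zero_rpow]
  exact inv_ne_zero (Nat.cast_ne_zero.mpr Module.finrank_pos.ne')

omit [FiniteDimensional K D] in
theorem divAbs_mul (x y : D) : divAbs K (x * y) = divAbs K x * divAbs K y := by
  rw [divAbs, map_mul, norm_mul, Real.mul_rpow (norm_nonneg _) (norm_nonneg _)]
  rfl

theorem divAbs_smul (t : K) (x : D) : divAbs K (t • x) = ‖t‖ * divAbs K x := by
  rw [Algebra.smul_def, divAbs_mul]
  congr 1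
  rw [divAbs, Algebra.norm_algebraMap, norm_pow, Real.pow_rpow_inv_natCast (norm_nonneg _)
    Module.finrank_pos.ne']

theorem divAbs_add_le_max [ProperSpace K] [IsUltrametricDist K] (x y : D) :
    divAbs K (x + y) ≤ max (divAbs K x) (divAbs K y) := by
  -- Truncation at `0` makes the real power monotone on all of `ℝ`, so that it commutes with `max`.
  have hmono : Monotone fun t : ℝ => (max t 0) ^ ((Module.finrank K D : ℝ)⁻¹) := fun a b hab =>
    Real.rpow_le_rpow (le_max_right _ _) (max_le_max_right _ hab) (by positivity)
  have h := (hmono (norm_algebraNorm_add_le_max K x y)).trans_eq hmono.map_max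
  simp only [max_eq_left (norm_nonneg _)] at h
  exact h

theorem divAbs_eq_zero {x : D} (hx : divAbs K x = 0) : x = 0 := by
  rw [divAbs, Real.rpow_eq_zero (norm_nonneg _)
    (inv_ne_zero (Nat.cast_ne_zero.mpr Module.finrank_pos.ne')), norm_eq_zero,
    Algebra.norm_eq_zero_iff] at hx
  exact hx

theorem divAbs_neg (x : D) : divAbs K (-x) = divAbs K x := by
  have := divAbs_smul K (-1) x
  rwa [neg_one_smul, norm_neg, norm_one, one_mul] at this

omit [FiniteDimensional K D] in
theorem divAbs_eq_one_of_norm_eq_one {x : D} (hx : Algebra.norm K x = 1) : divAbs K x = 1 := by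
  rw [divAbs, hx, norm_one, Real.one_rpow]

variable (D)

/-- The metric defined by the absolute value. -/
noncomputable abbrev divMetricSpace [ProperSpace K] [IsUltrametricDist K] : MetricSpace D where
  dist x y := divAbs K (-x + y)
  dist_self x := by rw [neg_add_cancel, divAbs_zero]
  dist_comm x y := by rw [← divAbs_neg, neg_add, neg_neg, add_comm]
  dist_triangle x y z := by
    have h : -x + z = (-x + y) + (-y + z) := by abel
    rw [h]
    exact (divAbs_add_le_max K _ _).trans
      (max_le_add_of_nonneg (divAbs_nonneg K _) (divAbs_nonneg K _))
  eq_of_dist_eq_zero {x y} h := by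
    rw [← sub_eq_zero, ← neg_eq_zero, neg_sub, sub_eq_add_neg, add_comm]
    exact divAbs_eq_zero K h

/-- A finite dimensional division algebra over a local field is a normed division ring. -/
noncomputable abbrev divNormedDivisionRing [ProperSpace K] [IsUltrametricDist K] :
    NormedDivisionRing D :=
  { toDivisionRing := divRing
    toMetricSpace := divMetricSpace K D
    norm := divAbs K
    dist_eq := fun _ _ => rfl
    norm_mul := divAbs_mul K }

/-- The absolute value extends the one of the field. -/
noncomputable abbrev divNormedAlgebra [ProperSpace K] [IsUltrametricDist K] :
    letI := divNormedDivisionRing K D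
    NormedAlgebra K D :=
  letI := divNormedDivisionRing K D
  { alg with norm_smul_le := fun t x => (divAbs_smul K t x).le }

theorem isUltrametricDist_div [ProperSpace K] [IsUltrametricDist K] :
    letI := divNormedDivisionRing K D
    IsUltrametricDist D :=
  letI := divNormedDivisionRing K D
  IsUltrametricDist.isUltrametricDist_of_forall_norm_add_le_max_norm (divAbs_add_le_max K)

theorem topology_eq_div [ProperSpace K] [IsUltrametricDist K] [t : TopologicalSpace D]
    [IsModuleTopology K D] :
    t = (divNormedDivisionRing K D).toMetricSpace.toUniformSpace.toTopologicalSpace := by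
  rw [eq_moduleTopology K D]
  exact (@NormedAlgebra.eq_moduleTopology_of_finite K D _ (divNormedDivisionRing K D)
    (divNormedAlgebra K D) _ _).symm

end AbsoluteValue

/-! ### Group theoretic structure of `SL₁` -/

section CSA

theorem exists_ne_eq_of_roots_mem_commutative {K : Type u} {D : Type v} [Field K] [DivisionRing D]
    [Algebra K D] {F : Subalgebra K D} (hF : ∀ a ∈ F, ∀ b ∈ F, a * b = b * a)
    {f : Polynomial K} (hf : f ≠ 0) (z : ℕ → D) (hz : ∀ i, z i ∈ F)
    (hroot : ∀ i, Polynomial.aeval (z i) f = 0) :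
    ∃ i j, i < j ∧ j ≤ f.natDegree ∧ z i = z j := by
  classical
  let _ : CommRing F :=
    { (inferInstance : Ring F) with mul_comm := fun a b => Subtype.ext (hF a a.2 b b.2) }
  have hdom : IsDomain F := F.toSubring.instIsDomainSubtypeMem
  let y : ℕ → F := fun i => ⟨z i, hz i⟩
  have hy : ∀ i, y i ∈ (f.aroots F).toFinset := fun i => by
    rw [Multiset.mem_toFinset, Polynomial.mem_aroots]
    refine ⟨hf, ?_⟩
    apply Subtype.val_injective
    have := Polynomial.aeval_algHom_apply F.val (y i) f
    rw [F.val_apply, F.val_apply] at this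
    rw [← this]
    exact hroot i
  have hcard : (f.aroots F).toFinset.card < (Finset.range (f.natDegree + 1)).card := by
    rw [Finset.card_range, Nat.lt_succ_iff]
    refine (Multiset.toFinset_card_le _).trans ?_
    exact (Polynomial.card_roots' _).trans Polynomial.natDegree_map_le
  obtain ⟨i, hi, j, hj, hij, h⟩ :=
    Finset.exists_ne_map_eq_of_card_lt_of_maps_to hcard (fun i _ => hy i)
  have h' : z i = z j := congrArg Subtype.val h
  rw [Finset.mem_range, Nat.lt_succ_iff] at hi hj
  rcases lt_or_gt_of_ne hij with hlt | hlt
  · exact ⟨i, j, hlt, hj, h'⟩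
  · exact ⟨j, i, hlt, hi, h'.symm⟩

variable {K : Type u} {D : Type v} [Field K] [DivisionRing D] [Algebra K D]

theorem Polynomial.aeval_units_conj (f : Polynomial K) (x : D) (h : Dˣ) :
    Polynomial.aeval ((h : D) * x * (h⁻¹ : Dˣ)) f = h * Polynomial.aeval x f * (h⁻¹ : Dˣ) :=
  (Polynomial.aeval_algHom_apply
    (MulSemiringAction.toAlgHom K D (ConjAct.toConjAct h)) x f)

variable {ℓ : ℕ} [Algebra.IsCentral K D] (hℓ : ℓ.Prime) (hD : Module.finrank K D = ℓ ^ 2)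
  (hK : ∀ c : K, c ^ ℓ = 1 → c = 1)
include hℓ hD

/-- Otherwise `h` is a root of `1 + X + ⋯ + X ^ (m - 1)`, of degree below `ℓ`, the degree of its
minimal polynomial. -/
theorem pow_ne_one_of_not_mem_bot {h : D} (hh : h ∉ (⊥ : Subalgebra K D)) {m : ℕ} (hm0 : m ≠ 0)
    (hm : m ≤ ℓ) : h ^ m ≠ 1 := by
  intro h1
  have h2 : (∑ i ∈ Finset.range m, h ^ i) = 0 := by
    have h3 : (∑ i ∈ Finset.range m, h ^ i) * (h - 1) = 0 := by rw [geom_sum_mul, h1, sub_self]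
    refine (mul_eq_zero.mp h3).resolve_right fun h4 => hh ?_
    rw [sub_eq_zero.mp h4]
    exact one_mem _
  have h3 := minpoly.dvd K h (p := ∑ i ∈ Finset.range m, Polynomial.X ^ i) (by simpa using h2)
  have h4 := Polynomial.natDegree_le_of_dvd h3 (Polynomial.monic_geom_sum_X hm0).ne_zero
  rw [natDegree_minpoly_eq hℓ hD hh] at h4
  have h5 : (∑ i ∈ Finset.range m, (Polynomial.X : Polynomial K) ^ i).natDegree ≤ m - 1 := by
    refine Polynomial.natDegree_sum_le_of_forall_le _ _ fun i hi => ?_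
    rw [Polynomial.natDegree_X_pow]
    exact Nat.le_sub_one_of_lt (Finset.mem_range.mp hi)
  omega

include hK

theorem eq_one_of_mem_SLOne_of_mem_bot {x : Dˣ} (hx : x ∈ SLOne K D)
    (h : (x : D) ∈ (⊥ : Subalgebra K D)) : x = 1 := by
  have : FiniteDimensional K D := Module.finite_of_finrank_pos (hD ▸ pow_pos hℓ.pos 2)
  rw [mem_SLOne_iff_norm_eq_one hℓ hD hK] at hx
  obtain ⟨c, hc⟩ := Algebra.mem_bot.mp h
  rw [← hc, Algebra.norm_algebraMap, hD, sq, pow_mul] at hx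
  -- The norm of a scalar `c` is `(c ^ ℓ) ^ ℓ`, so the root-of-unity hypothesis is used twice.
  have := hK _ (hK _ hx)
  ext
  rw [← hc, this, map_one, Units.val_one]

theorem not_mem_bot_of_ne_one {x : SLOne K D} (hx : x ≠ 1) :
    ((x : Dˣ) : D) ∉ (⊥ : Subalgebra K D) :=
  fun h => hx (Subtype.ext (eq_one_of_mem_SLOne_of_mem_bot hℓ hD hK x.2 h))

theorem isCAGroup_SLOne : IsCAGroup (SLOne K D) := by
  intro g hg x hx y hy
  rw [Subgroup.mem_centralizer_singleton_iff] at hx hy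
  have h1 := commute_of_commute_of_commute hℓ hD (not_mem_bot_of_ne_one hℓ hD hK hg)
    (y := ((x : Dˣ) : D)) (z := ((y : Dˣ) : D))
    (congrArg (fun t : SLOne K D => ((t : Dˣ) : D)) hx).symm
    (congrArg (fun t : SLOne K D => ((t : Dˣ) : D)) hy).symm
  exact Subtype.ext (Units.ext h1)

theorem commute_of_commute_conj {x y : D} {h : Dˣ} (hh : h ∈ SLOne K D)
    (hx : x ∉ (⊥ : Subalgebra K D)) (hxy : Commute x y) (hxh : x = h * y * (h⁻¹ : Dˣ)) :
    Commute x h := by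
  have : FiniteDimensional K D := Module.finite_of_finrank_pos (hD ▸ pow_pos hℓ.pos 2)
  by_contra hne
  let F := Subalgebra.centralizer K {x}
  have hF : ∀ a, a ∈ F ↔ Commute x a := fun a => by
    simp only [F, Subalgebra.mem_centralizer_iff, Set.mem_singleton_iff, forall_eq]
    rfl
  -- Conjugation by `h` carries the centralizer of `y` to that of `x`, and these coincide.
  have hstep : ∀ a, Commute x a → Commute x (h * a * (h⁻¹ : Dˣ)) := fun a ha => by
    have h1 : Commute y a := commute_of_commute_of_commute hℓ hD hx hxy ha
    rw [hxh]
    change _ * _ = _ * _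
    simp only [mul_assoc, Units.inv_mul_cancel_left]
    rw [← mul_assoc y, h1.eq, mul_assoc]
  have hpow : ∀ i : ℕ, Commute x ((h ^ i : Dˣ) * x * ((h ^ i)⁻¹ : Dˣ)) := fun i => by
    induction i with
    | zero => simp
    | succ i ih =>
      convert hstep _ ih using 1
      simp only [pow_succ', mul_inv_rev, Units.val_mul, mul_assoc]
  -- The conjugates of `x` by powers of `h` are roots of `minpoly K x` in a commutative domain;
  -- among the first `ℓ + 1` two agree.
  obtain ⟨i, j, hij, hj, hz⟩ := exists_ne_eq_of_roots_mem_commutative (F := F)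
    (fun a ha b hb => commute_of_commute_of_commute hℓ hD hx ((hF a).mp ha) ((hF b).mp hb))
    (minpoly.ne_zero (Algebra.IsIntegral.isIntegral (R := K) x))
    (fun i => (h ^ i : Dˣ) * x * ((h ^ i)⁻¹ : Dˣ)) (fun i => (hF _).mpr (hpow i))
    (fun i => by rw [Polynomial.aeval_units_conj, minpoly.aeval, mul_zero, zero_mul])
  rw [natDegree_minpoly_eq hℓ hD hx] at hj
  obtain ⟨m, rfl⟩ := Nat.exists_eq_add_of_lt hij
  have hcomm : Commute ((h : D) ^ (m + 1)) x := by
    have h1 : x = (h ^ (m + 1) : Dˣ) * x * ((h ^ (m + 1))⁻¹ : Dˣ) := by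
      have h2 := congrArg (fun t : D => ((h ^ i)⁻¹ : Dˣ) * t * (h ^ i : Dˣ)) hz
      simp only [add_assoc i m 1, pow_add h i, mul_inv_rev, Units.val_mul, mul_assoc,
        Units.inv_mul_cancel_left, Units.inv_mul, mul_one] at h2
      simpa only [mul_assoc] using h2
    rw [← Units.val_pow_eq_pow_val]
    change _ * _ = _ * _
    conv_rhs => rw [h1]
    rw [Units.inv_mul_cancel_right]
  have hbot : (h : D) ^ (m + 1) ∈ (⊥ : Subalgebra K D) := by
    by_contra hb
    exact hne (commute_of_commute_of_commute hℓ hD hb hcomm ((Commute.refl (h : D)).pow_left _))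
  have hone : h ^ (m + 1) = 1 :=
    eq_one_of_mem_SLOne_of_mem_bot hℓ hD hK (pow_mem hh _) (by simpa using hbot)
  refine pow_ne_one_of_not_mem_bot hℓ hD (h := (h : D)) (fun hb => hne ?_) (m.succ_ne_zero)
    (by omega) (by rw [← Units.val_pow_eq_pow_val, hone, Units.val_one])
  obtain ⟨c, hc⟩ := Algebra.mem_bot.mp hb
  rw [← hc]
  exact (Algebra.commutes c x).symm

theorem isMalnormal_centralizer_SLOne {g : SLOne K D} (hg : g ≠ 1) :
    IsMalnormal (Subgroup.centralizer ({g} : Set (SLOne K D))) := by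
  intro h hh
  rw [eq_bot_iff]
  rintro x ⟨hx, y, hy, hxy⟩
  change x ∈ Subgroup.centralizer {g} at hx
  rw [SetLike.mem_coe, Subgroup.mem_centralizer_singleton_iff] at hy
  rw [Subgroup.mem_centralizer_singleton_iff] at hx
  rw [Subgroup.mem_bot]
  by_contra hx1
  apply hh
  rw [Subgroup.mem_centralizer_singleton_iff]
  have hx' := not_mem_bot_of_ne_one hℓ hD hK hx1
  have hxy' : x = h * y * h⁻¹ := hxy.symm
  have h1 := isCAGroup_SLOne hℓ hD hK g hg x (Subgroup.mem_centralizer_singleton_iff.mpr hx) y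
    (Subgroup.mem_centralizer_singleton_iff.mpr hy)
  have h2 := commute_of_commute_conj hℓ hD hK (x := ((x : Dˣ) : D)) (y := ((y : Dˣ) : D)) h.2 hx'
    (congrArg (fun t : SLOne K D => ((t : Dˣ) : D)) h1)
    (congrArg (fun t : SLOne K D => ((t : Dˣ) : D)) hxy')
  have h3 := commute_of_commute_of_commute hℓ hD hx' h2
    (z := ((g : Dˣ) : D)) (congrArg (fun t : SLOne K D => ((t : Dˣ) : D)) hx)
  exact Subtype.ext (Units.ext h3)

theorem isCSAGroup_SLOne : IsCSAGroup (SLOne K D) :=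
  ⟨isCAGroup_SLOne hℓ hD hK, fun _ hg => isMalnormal_centralizer_SLOne hℓ hD hK hg⟩

/-! ### Non-commutativity -/

omit hK in
theorem exists_not_commute : ∃ x y : D, ¬ Commute x y := by
  by_contra! h
  have h1 : (⊥ : Subalgebra K D) = ⊤ := by
    rw [← Algebra.IsCentral.center_eq_bot K D, eq_top_iff]
    exact fun x _ => Subalgebra.mem_center_iff.mpr fun b => h b x
  have h2 := Subalgebra.bot_eq_top_iff_finrank_eq_one.mp h1
  rw [hD] at h2
  have := hℓ.one_lt
  nlinarith

/-- Cartan–Brauer–Hua: the group is normal in `Dˣ`, so if it were abelian each of its elements would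
commute with all its conjugates. A non-trivial commutator `c` is non-central; comparing its
conjugates by `x` and `1 + x` then forces `x` to commute with `c`. -/
theorem not_commutative_SLOne : ¬ ∀ x y : SLOne K D, x * y = y * x := by
  have : FiniteDimensional K D := Module.finite_of_finrank_pos (hD ▸ pow_pos hℓ.pos 2)
  have hmem := mem_SLOne_iff_norm_eq_one hℓ hD hK
  intro hcomm
  have hconj : ∀ (g : SLOne K D) (u : Dˣ),
      Commute ((g : Dˣ) : D) ((u : D) * ((g : Dˣ) : D) * (u⁻¹ : Dˣ)) := fun g u => by
    have h1 : u * g * u⁻¹ ∈ SLOne K D := by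
      have h2 := (hmem g).mp g.2
      rw [hmem, Units.val_mul, Units.val_mul, map_mul, map_mul, h2, mul_one, ← map_mul,
        Units.mul_inv, map_one]
    exact congrArg (fun t : SLOne K D => ((t : Dˣ) : D)) (hcomm g ⟨_, h1⟩)
  obtain ⟨a, b, hab⟩ := exists_not_commute hℓ hD
  have ha : a ≠ 0 := by rintro rfl; exact hab (Commute.zero_left b)
  have hb : b ≠ 0 := by rintro rfl; exact hab (Commute.zero_right a)
  let A := Units.mk0 a ha
  let B := Units.mk0 b hb
  have hg : A * B * A⁻¹ * B⁻¹ ∈ SLOne K D := by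
    have h1 : Algebra.norm K (A : D) * Algebra.norm K ((A⁻¹ : Dˣ) : D) = 1 := by
      rw [← map_mul, Units.mul_inv, map_one]
    have h2 : Algebra.norm K (B : D) * Algebra.norm K ((B⁻¹ : Dˣ) : D) = 1 := by
      rw [← map_mul, Units.mul_inv, map_one]
    rw [hmem]
    simp only [Units.val_mul, map_mul]
    linear_combination Algebra.norm K (B : D) * Algebra.norm K ((B⁻¹ : Dˣ) : D) * h1 + h2
  let g : SLOne K D := ⟨_, hg⟩
  have hg1 : g ≠ 1 := fun h => by
    have h1 : A * B * A⁻¹ * B⁻¹ = 1 := congrArg Subtype.val h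
    exact hab (congrArg Units.val (mul_inv_eq_iff_eq_mul.mp (mul_inv_eq_one.mp h1)))
  have hgb := not_mem_bot_of_ne_one hℓ hD hK hg1
  set c : D := ((g : Dˣ) : D) with hc
  obtain ⟨x, hx⟩ : ∃ x, ¬ Commute c x := by
    by_contra! h
    apply hgb
    rw [← Algebra.IsCentral.center_eq_bot K D, Subalgebra.mem_center_iff]
    exact fun b => (h b).eq.symm
  have hx0 : x ≠ 0 := by rintro rfl; exact hx (Commute.zero_right c)
  have hx1 : 1 + x ≠ 0 := fun h => by
    apply hx
    rw [← neg_eq_of_add_eq_zero_right h]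
    exact (Commute.one_right c).neg_right
  have h1 := hconj g (Units.mk0 x hx0)
  have h2 := hconj g (Units.mk0 (1 + x) hx1)
  simp only [Units.val_mk0, Units.val_inv_eq_inv_val, ← hc] at h1 h2
  set c' := x * c * x⁻¹ with hc'
  set c'' := (1 + x) * c * (1 + x)⁻¹ with hc''
  have e1 : c' * x = x * c := by rw [hc', inv_mul_cancel_right₀ hx0]
  have e2 : c'' * (1 + x) = (1 + x) * c := by rw [hc'', inv_mul_cancel_right₀ hx1]
  -- Either `c'' = c'`, and both equal `c`, or `x` is a quotient of elements commuting with `c`.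
  have e3 : (c'' - c') * x = c - c'' := by
    rw [sub_mul, e1]
    rw [mul_add, add_mul, one_mul, mul_one] at e2
    rw [sub_eq_sub_iff_add_eq_add, add_comm]
    exact e2
  by_cases h : c'' - c' = 0
  · rw [h, zero_mul] at e3
    apply hx
    change c * x = x * c
    rw [← e1, ← sub_eq_zero.mp h, ← sub_eq_zero.mp e3.symm]
  · apply hx
    have : x = (c'' - c')⁻¹ * (c - c'') := by rw [← e3, inv_mul_cancel_left₀ h]
    rw [this]
    exact ((h2.sub_right h1).inv_right₀).mul_right ((Commute.refl c).sub_right h2)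

end CSA

/-! ### Profiniteness of `SL₁` -/

section Topological

theorem continuous_algebraNorm (K : Type u) (D : Type v) [NontriviallyNormedField K]
    [CompleteSpace K] [NormedDivisionRing D] [NormedAlgebra K D] [FiniteDimensional K D] :
    Continuous fun x : D => Algebra.norm K x := by
  have h : (fun x : D => Algebra.norm K x) =
      fun x => ((Algebra.leftMulMatrix (Module.finBasis K D)).toLinearMap x).det := by
    ext x
    exact Algebra.norm_eq_matrix_det (Module.finBasis K D) _
  rw [h]
  exact (LinearMap.continuous_of_finiteDimensional _).matrix_det

theorem isProfiniteGroup_of_range_val {D : Type v} [NormedDivisionRing D] [IsUltrametricDist D]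
    [ProperSpace D] (G : Subgroup Dˣ) (hclosed : IsClosed {x : D | ∃ g ∈ G, (g : D) = x})
    (hbdd : ∀ g ∈ G, ‖(g : D)‖ ≤ 1) : IsProfiniteGroup G where
  isTopologicalGroup := inferInstance
  compactSpace := by
    have hemb : Topology.IsEmbedding fun g : G => ((g : Dˣ) : D) :=
      Units.isEmbedding_val₀.comp Topology.IsEmbedding.subtypeVal
    have himage : (fun g : G => ((g : Dˣ) : D)) '' Set.univ = {x : D | ∃ g ∈ G, (g : D) = x} := by
      ext x
      simp
    rw [← isCompact_univ_iff, hemb.isCompact_iff, himage]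
    refine (isCompact_closedBall (0 : D) 1).of_isClosed_subset hclosed ?_
    rintro _ ⟨g, hg, rfl⟩
    simpa using hbdd g hg
  totallyDisconnectedSpace := by
    have hemb : Topology.IsEmbedding fun g : G => ((g : Dˣ) : D) :=
      Units.isEmbedding_val₀.comp Topology.IsEmbedding.subtypeVal
    exact ⟨hemb.isTotallyDisconnected (isTotallyDisconnected_of_totallyDisconnectedSpace _)⟩

/-- A profinite group with a non-trivial element of finite order prime to `p` is not pro-`p`. -/
theorem not_isProPGroup_of_pow_eq_one {p : ℕ} (hp : p.Prime) {G : Type u} [Group G]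
    [TopologicalSpace G] {g : G} (hg : g ≠ 1) {m : ℕ} (hm : ¬ p ∣ m) (hgm : g ^ m = 1) :
    ¬ IsProPGroup p G := by
  rintro ⟨⟨h1, h2, h3⟩, h⟩
  obtain ⟨N, hN⟩ := ProfiniteGrp.exist_openNormalSubgroup_sub_open_nhds_of_one
    (isOpen_compl_singleton (x := g)) (fun h => hg h.symm)
  obtain ⟨k, hk⟩ := h N
  have hgN : g ∈ N.toSubgroup := by
    have h4 : g ^ p ^ k ∈ N.toSubgroup := hk ▸ N.toSubgroup.pow_index_mem g
    have h5 : Nat.Coprime (p ^ k) m := Nat.Coprime.pow_left k ((hp.coprime_iff_not_dvd).mpr hm)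
    -- Bézout: `g` lies in `N` because its powers with the coprime exponents `p ^ k` and `m` do.
    have h6 : g ^ ((p ^ k).gcd m : ℤ) ∈ N.toSubgroup := by
      rw [Nat.gcd_eq_gcd_ab, zpow_add, zpow_mul, zpow_mul, zpow_natCast, zpow_natCast, hgm,
        one_zpow, mul_one]
      exact zpow_mem h4 _
    simpa [h5.gcd_eq_one] using h6
  exact hN hgN rfl

end Topological

/-! ### Elements of finite order prime to `p` -/

section Torsion

/-! ### A residue class outside the residue field of the base -/

section LocalField

variable {K : Type u} {D : Type v} [NontriviallyNormedField K] [ProperSpace K]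
  [NormedDivisionRing D] [NormedAlgebra K D] [FiniteDimensional K D] [IsUltrametricDist D]

/-- If `D` is not generated by one element, its residue algebra is not that of `K`. -/
theorem exists_norm_sub_algebraMap_ge (hD : ∀ x : D, Algebra.adjoin K {x} ≠ ⊤) :
    ∃ x : D, ‖x‖ ≤ 1 ∧ ∀ a : K, 1 ≤ ‖x - algebraMap K D a‖ := by
  by_contra! hcon
  have : ProperSpace D := FiniteDimensional.proper K D
  -- A uniformizer: the open unit ball is also closed, hence compact, so the norm attains its
  -- maximum there.
  obtain ⟨ϖ, hϖ, hmax⟩ : ∃ ϖ ∈ Metric.ball (0 : D) 1, ∀ x ∈ Metric.ball (0 : D) 1, ‖x‖ ≤ ‖ϖ‖ := by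
    have hc : IsCompact (Metric.ball (0 : D) 1) :=
      (isCompact_closedBall (0 : D) 1).of_isClosed_subset (IsUltrametricDist.isClosed_ball 0 1)
        Metric.ball_subset_closedBall
    obtain ⟨ϖ, hϖ, h⟩ := hc.exists_isMaxOn ⟨0, by simp⟩ continuous_norm.continuousOn
    exact ⟨ϖ, hϖ, isMaxOn_iff.mp h⟩
  rw [mem_ball_zero_iff] at hϖ
  have hϖ0 : 0 < ‖ϖ‖ := by
    obtain ⟨t, ht0, ht1⟩ := NormedField.exists_norm_lt_one K
    have := hmax (algebraMap K D t) (by rwa [mem_ball_zero_iff, norm_algebraMap'])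
    rw [norm_algebraMap'] at this
    exact ht0.trans_le this
  have hϖ' : ϖ ≠ 0 := norm_pos_iff.mp hϖ0
  set A := Algebra.adjoin K {ϖ} with hA
  have hϖA : ϖ ∈ A := Algebra.self_mem_adjoin_singleton K ϖ
  -- Expansion in powers of `ϖ` with digits in `K`: the unit ball lies in the closure of `K[ϖ]`,
  -- which is closed, so `ϖ` would generate `D`.
  have happrox : ∀ n : ℕ, ∀ x : D, ‖x‖ ≤ 1 → ∃ a ∈ A, ‖x - a‖ ≤ ‖ϖ‖ ^ n := by
    intro n
    induction n with
    | zero => exact fun x hx => ⟨0, zero_mem _, by simpa using hx⟩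
    | succ n ih =>
      intro x hx
      obtain ⟨c, hc⟩ := hcon x hx
      have h1 := hmax _ (mem_ball_zero_iff.mpr hc)
      obtain ⟨a, ha, h2⟩ := ih (ϖ⁻¹ * (x - algebraMap K D c)) (by
        rw [norm_mul, norm_inv, inv_mul_le_iff₀ hϖ0, mul_one]
        exact h1)
      refine ⟨algebraMap K D c + ϖ * a, add_mem (A.algebraMap_mem c) (mul_mem hϖA ha), ?_⟩
      have h3 : x - (algebraMap K D c + ϖ * a) =
          ϖ * (ϖ⁻¹ * (x - algebraMap K D c) - a) := by
        rw [mul_sub, mul_inv_cancel_left₀ hϖ', sub_add_eq_sub_sub]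
      rw [h3, norm_mul, pow_succ']
      gcongr
  have hclosed : IsClosed (A : Set D) :=
    Submodule.closed_of_finiteDimensional (Subalgebra.toSubmodule A)
  have hball : ∀ x : D, ‖x‖ ≤ 1 → x ∈ A := by
    intro x hx
    rw [← SetLike.mem_coe, ← hclosed.closure_eq, Metric.mem_closure_iff]
    intro ε hε
    obtain ⟨n, hn⟩ := exists_pow_lt_of_lt_one hε hϖ
    obtain ⟨a, ha, h⟩ := happrox n x hx
    exact ⟨a, ha, by rw [dist_eq_norm]; exact h.trans_lt hn⟩
  refine hD ϖ (eq_top_iff.mpr fun x _ => ?_)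
  obtain ⟨t, ht0, ht⟩ := NormedField.exists_norm_lt K (r := (‖x‖ + 1)⁻¹) (by positivity)
  have ht' : t ≠ 0 := norm_pos_iff.mp ht0
  have h1 : t • x ∈ A := by
    apply hball
    rw [norm_smul]
    have h2 : (‖x‖ + 1)⁻¹ * (‖x‖ + 1) = 1 := inv_mul_cancel₀ (by positivity)
    nlinarith [norm_nonneg x]
  have h2 := A.smul_mem h1 t⁻¹
  rwa [smul_smul, inv_mul_cancel₀ ht', one_smul] at h2

end LocalField

/-! ### Frobenius congruences and Teichmüller lifts -/

section Padic

open Polynomial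

theorem norm_sub_le_max {E : Type*} [SeminormedAddCommGroup E] [IsUltrametricDist E] (x y : E) :
    ‖x - y‖ ≤ max ‖x‖ ‖y‖ := by
  rw [sub_eq_add_neg, ← norm_neg y]
  exact IsUltrametricDist.norm_add_le_max x (-y)

variable {p : ℕ} [Fact p.Prime] {D : Type v} [NormedDivisionRing D] [IsUltrametricDist D]

theorem norm_aeval_int_le_one (Q : ℤ[X]) {x : D} (hx : ‖x‖ ≤ 1) : ‖aeval x Q‖ ≤ 1 := by
  rw [aeval_eq_sum_range]
  refine IsUltrametricDist.norm_sum_le_of_forall_le_of_nonneg zero_le_one fun i _ => ?_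
  rw [zsmul_eq_mul, norm_mul, norm_pow]
  exact mul_le_one₀ (IsUltrametricDist.norm_intCast_le_one D _) (by positivity)
    (pow_le_one₀ (norm_nonneg _) hx)

variable (hpD : ‖(p : D)‖ < 1)
include hpD

theorem norm_aeval_lt_one_of_map_eq_zero {Q : ℤ[X]} (hQ : Q.map (Int.castRingHom (ZMod p)) = 0)
    {x : D} (hx : ‖x‖ ≤ 1) : ‖aeval x Q‖ < 1 := by
  obtain ⟨R, rfl⟩ : C (p : ℤ) ∣ Q := by
    rw [C_dvd_iff_dvd_coeff]
    intro i
    rw [← ZMod.intCast_zmod_eq_zero_iff_dvd]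
    simpa using congrArg (fun q => q.coeff i) hQ
  rw [map_mul, norm_mul, aeval_C]
  refine mul_lt_one_of_nonneg_of_lt_one_left (norm_nonneg _) ?_ (norm_aeval_int_le_one R hx)
  simpa using hpD

/-- Frobenius on the commutative ring `ℤ[x]`: `(x - 1) ^ p` and `x ^ p - 1` agree modulo `p`. -/
theorem norm_sub_one_lt_of_norm_pow_prime_sub_one_lt {x : D} (hx : ‖x‖ ≤ 1)
    (h : ‖x ^ p - 1‖ < 1) : ‖x - 1‖ < 1 := by
  have h1 : ‖aeval x ((X - 1) ^ p - (X ^ p - 1) : ℤ[X])‖ < 1 := by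
    refine norm_aeval_lt_one_of_map_eq_zero hpD ?_ hx
    simp [sub_pow_char]
  simp only [map_sub, map_pow, aeval_X, map_one] at h1
  have h2 : ‖(x - 1) ^ p‖ < 1 := by
    have h3 : (x - 1) ^ p = ((x - 1) ^ p - (x ^ p - 1)) + (x ^ p - 1) := by abel
    rw [h3]
    exact (IsUltrametricDist.norm_add_le_max _ _).trans_lt (max_lt h1 h)
  rw [norm_pow] at h2
  by_contra! h4
  exact absurd (one_le_pow₀ (n := p) h4) h2.not_ge

/-- Modulo `p`, `x ^ p - x` is the product of the `x - a` over residues `a`, each factor having norm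
at least `1`. -/
theorem one_le_norm_pow_prime_sub_self {x : D} (hx : ‖x‖ ≤ 1)
    (h : ∀ n : ℤ, 1 ≤ ‖x - n‖) : 1 ≤ ‖x ^ p - x‖ := by
  have hprod : ∏ a : ZMod p, (X - C a) = (X ^ p - X : (ZMod p)[X]) := by
    have hp1 : 1 < p := (Fact.out : p.Prime).one_lt
    have h1 := FiniteField.roots_X_pow_card_sub_X (ZMod p)
    rw [ZMod.card] at h1
    have h2 := prod_multiset_X_sub_C_of_monic_of_roots_card_eq
      (p := (X ^ p - X : (ZMod p)[X])) (monic_X_pow_sub (by rw [degree_X]; exact_mod_cast hp1))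
      (by rw [h1, FiniteField.X_pow_card_sub_X_natDegree_eq _ hp1]; simp [ZMod.card])
    rw [h1] at h2
    exact h2
  let P : ℤ[X] := ∏ a : ZMod p, (X - C (a.val : ℤ))
  have h1 : ‖aeval x (X ^ p - X - P)‖ < 1 := by
    refine norm_aeval_lt_one_of_map_eq_zero hpD ?_ hx
    have hP : P.map (Int.castRingHom (ZMod p)) = X ^ p - X := by
      rw [← hprod, Polynomial.map_prod]
      refine Finset.prod_congr rfl fun a _ => ?_
      rw [Polynomial.map_sub, map_X, map_C, eq_intCast, Int.cast_natCast, ZMod.natCast_zmod_val]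
    rw [Polynomial.map_sub, Polynomial.map_sub, Polynomial.map_pow, map_X, hP, sub_self]
  have h2 : 1 ≤ ‖aeval x P‖ := by
    let f : ℤ[X] →* ℝ := (normHom : D →*₀ ℝ).toMonoidHom.comp (aeval x : ℤ[X] →ₐ[ℤ] D)
    change 1 ≤ f P
    rw [map_prod]
    refine Finset.prod_induction _ (1 ≤ ·) (fun _ _ => one_le_mul_of_one_le_of_one_le) le_rfl
      fun a _ => ?_
    change 1 ≤ ‖aeval x (X - C (a.val : ℤ))‖
    rw [map_sub, aeval_X, aeval_C]
    exact h a.val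
  simp only [map_sub, map_pow, aeval_X] at h1
  by_contra! h3
  have h4 : aeval x P = (x ^ p - x) - (x ^ p - x - aeval x P) := by abel
  rw [h4] at h2
  exact absurd ((norm_sub_le_max _ _).trans_lt (max_lt h3 h1)) h2.not_gt

omit hpD in
theorem norm_pow_sub_one_le {x : D} (hx : ‖x‖ ≤ 1) (n : ℕ) : ‖x ^ n - 1‖ ≤ ‖x - 1‖ := by
  rw [← geom_sum_mul, norm_mul]
  refine mul_le_of_le_one_left (norm_nonneg _) ?_
  refine IsUltrametricDist.norm_sum_le_of_forall_le_of_nonneg zero_le_one fun i _ => ?_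
  rw [norm_pow]
  exact pow_le_one₀ (norm_nonneg _) hx

omit hpD [Fact p.Prime] in
-- The `p` terms of the geometric sum are all close to `1`, so the sum is close to `p`, which is
-- small. Iterated, this contraction gives `tendsto_pow_prime_pow`.
theorem norm_pow_prime_sub_one_le {x : D} (hx : ‖x‖ ≤ 1) {r : ℝ} (hr : ‖x - 1‖ ≤ r)
    (hpr : ‖(p : D)‖ ≤ r) : ‖x ^ p - 1‖ ≤ r * ‖x - 1‖ := by
  have hr0 : 0 ≤ r := (norm_nonneg _).trans hr
  rw [← geom_sum_mul, norm_mul]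
  gcongr
  have h1 : ∑ i ∈ Finset.range p, x ^ i = ∑ i ∈ Finset.range p, (x ^ i - 1) + p := by
    simp [Finset.sum_sub_distrib]
  rw [h1]
  refine (IsUltrametricDist.norm_add_le_max _ _).trans (max_le ?_ hpr)
  exact IsUltrametricDist.norm_sum_le_of_forall_le_of_nonneg hr0 fun i _ =>
    (norm_pow_sub_one_le hx i).trans hr

omit [Fact p.Prime] in
open Filter Topology in
theorem tendsto_pow_prime_pow {x : D} (hx : ‖x‖ ≤ 1) (h : ‖x - 1‖ < 1) :
    Tendsto (fun n : ℕ => x ^ p ^ n) atTop (𝓝 1) := by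
  set r := max ‖x - 1‖ ‖(p : D)‖ with hr
  have hr0 : 0 ≤ r := (norm_nonneg _).trans (le_max_left _ _)
  have hr1 : r < 1 := max_lt h hpD
  have hbound : ∀ n : ℕ, ‖x ^ p ^ n - 1‖ ≤ r ^ n := by
    intro n
    induction n with
    | zero => simpa using h.le
    | succ n ih =>
      have h1 : ‖x ^ p ^ n‖ ≤ 1 := by
        rw [norm_pow]
        exact pow_le_one₀ (norm_nonneg _) hx
      have h2 := norm_pow_prime_sub_one_le (p := p) h1
        ((norm_pow_sub_one_le hx (p ^ n)).trans (le_max_left _ _)) (le_max_right _ _)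
      rw [← pow_mul, ← pow_succ] at h2
      exact h2.trans (by rw [pow_succ']; gcongr)
  rw [tendsto_iff_norm_sub_tendsto_zero]
  exact squeeze_zero (fun _ => norm_nonneg _) hbound (tendsto_pow_atTop_nhds_zero_of_lt_one hr0 hr1)

/-- Every unit of the ring of integers has a power prime to `p` congruent to `1`. -/
theorem exists_not_dvd_norm_pow_sub_one_lt [ProperSpace D] {x : D} (hx : ‖x‖ = 1) :
    ∃ m : ℕ, ¬ p ∣ m ∧ ‖x ^ m - 1‖ < 1 := by
  classical
  have hex : ∃ m : ℕ, 0 < m ∧ ‖x ^ m - 1‖ < 1 := by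
    obtain ⟨a, -, φ, hφ, hlim⟩ := (isCompact_closedBall (0 : D) 1).tendsto_subseq
      (x := fun n : ℕ => x ^ n) (fun n => by simp [hx])
    obtain ⟨N, hN⟩ := Metric.cauchySeq_iff'.mp hlim.cauchySeq 1 one_pos
    have h1 := hN (N + 1) (Nat.le_succ N)
    obtain ⟨k, hk⟩ := Nat.exists_eq_add_of_lt (hφ (Nat.lt_succ_self N))
    refine ⟨k + 1, k.succ_pos, ?_⟩
    rw [dist_eq_norm] at h1
    simp only [Function.comp_apply] at h1
    rw [show φ (N + 1) = φ N + (k + 1) from hk, pow_add, ← mul_sub_one, norm_mul, norm_pow, hx,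
      one_pow, one_mul] at h1
    exact h1
  -- In the least such exponent a factor `p` could be cancelled by Frobenius.
  refine ⟨Nat.find hex, fun ⟨k, hk⟩ => ?_, (Nat.find_spec hex).2⟩
  obtain ⟨h1, h2⟩ := Nat.find_spec hex
  rw [hk, mul_comm, pow_mul] at h2
  have h3 := norm_sub_one_lt_of_norm_pow_prime_sub_one_lt hpD (x := x ^ k) (by simp [hx]) h2
  have hk0 : 0 < k := Nat.pos_of_ne_zero (by rintro rfl; omega)
  refine Nat.find_min hex (m := k) ?_ ⟨hk0, h3⟩
  rw [hk]
  exact lt_mul_of_one_lt_left hk0 (Fact.out : p.Prime).one_lt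

open Filter Topology in
/-- Every unit of the ring of integers is congruent to a root of unity of order prime to `p`. -/
theorem exists_pow_eq_one_norm_sub_lt [ProperSpace D] {x : D} (hx : ‖x‖ = 1) :
    ∃ (m : ℕ) (w : D), ¬ p ∣ m ∧ w ^ m = 1 ∧ ‖w - x‖ < 1 := by
  obtain ⟨m, hm, h⟩ := exists_not_dvd_norm_pow_sub_one_lt hpD hx
  have hp : p.Prime := Fact.out
  have hm0 : 0 < m := Nat.pos_of_ne_zero (by rintro rfl; exact hm (dvd_zero p))
  have hxm : ‖x ^ m‖ ≤ 1 := by simp [hx]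
  -- As `p ^ (t * n)` is `1` modulo `m`, the powers `x ^ p ^ (t * n)` stay congruent to `x`, while
  -- their `m`-th powers tend to `1`; `w` is a limit point.
  set t := m.totient with ht
  have ht0 : 0 < t := Nat.totient_pos.mpr hm0
  have hmod : ∀ n, p ^ (t * n) ≡ 1 [MOD m] := fun n => by
    have h1 := (Nat.ModEq.pow_totient ((hp.coprime_iff_not_dvd).mpr hm)).pow n
    rwa [one_pow, ← pow_mul] at h1
  have hclose : ∀ n, ‖x ^ p ^ (t * n) - x‖ < 1 := fun n => by
    obtain ⟨s, hs⟩ := (Nat.modEq_iff_dvd' (Nat.one_le_pow _ _ hp.pos)).mp (hmod n).symm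
    have h1 : p ^ (t * n) = m * s + 1 := by
      have := Nat.one_le_pow (t * n) p hp.pos
      omega
    rw [h1, pow_succ, ← sub_one_mul, norm_mul, hx, mul_one, pow_mul]
    exact (norm_pow_sub_one_le hxm s).trans_lt h
  obtain ⟨w, -, φ, hφ, hlim⟩ := (isCompact_closedBall (0 : D) 1).tendsto_subseq
    (x := fun n : ℕ => x ^ p ^ (t * n)) (fun n => by simp [hx])
  refine ⟨m, w, hm, ?_, ?_⟩
  · have h1 := hlim.pow m
    have h2 : Tendsto (fun n => t * φ n) atTop atTop :=
      (Filter.tendsto_id.const_mul_atTop' ht0).comp hφ.tendsto_atTop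
    have h3 := (tendsto_pow_prime_pow hpD hxm h).comp h2
    refine tendsto_nhds_unique h1 (h3.congr fun n => ?_)
    simp only [Function.comp_apply, ← pow_mul, mul_comm]
  · obtain ⟨N, hN⟩ := Metric.tendsto_atTop.mp hlim 1 one_pos
    have h1 := hN N le_rfl
    rw [dist_eq_norm, ← norm_neg, neg_sub] at h1
    have h2 : w - x = (w - x ^ p ^ (t * φ N)) + (x ^ p ^ (t * φ N) - x) := by abel
    rw [h2]
    exact (IsUltrametricDist.norm_add_le_max _ _).trans_lt (max_lt h1 (hclose _))

end Padic

section Main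

variable {p : ℕ} [Fact p.Prime] {D : Type v} [NormedDivisionRing D] [NormedAlgebra ℚ_[p] D]
  [IsUltrametricDist D] [FiniteDimensional ℚ_[p] D]

/-- By Fermat `c ^ (p - 1)` is congruent to `1`, and a root of unity of order prime to `p` with that
property is `1`. -/
theorem Padic.pow_sub_one_eq_one_of_pow_eq_one {c : ℚ_[p]} {m : ℕ} (hm : ¬ p ∣ m) (h : c ^ m = 1) :
    c ^ (p - 1) = 1 := by
  have hm0 : m ≠ 0 := by rintro rfl; exact hm (dvd_zero p)
  have hn : ‖c‖ = 1 := by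
    have := congrArg norm h
    rw [norm_pow, norm_one] at this
    exact (pow_eq_one_iff_of_nonneg (norm_nonneg _) hm0).mp this
  obtain ⟨z, rfl⟩ : ∃ y : ℤ_[p], (y : ℚ_[p]) = c := ⟨⟨c, hn.le⟩, rfl⟩
  have hz : z ^ m = 1 := Subtype.ext (by simpa using h)
  have h1 : ‖z ^ (p - 1) - 1‖ < 1 := by
    rw [PadicInt.norm_lt_one_iff_dvd, ← Ideal.mem_span_singleton,
      ← PadicInt.maximalIdeal_eq_span_p, ← PadicInt.ker_toZMod, RingHom.mem_ker, map_sub, map_one,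
      sub_eq_zero, map_pow]
    apply ZMod.pow_card_sub_one_eq_one
    exact ((IsUnit.of_pow_eq_one hz hm0).map PadicInt.toZMod).ne_zero
  have h2 := eq_one_of_pow_eq_one_of_norm_sub_one_lt h1 hm (by rw [pow_right_comm, hz, one_pow])
  simpa using congrArg (fun y : ℤ_[p] => (y : ℚ_[p])) h2

/-- If `D` is not generated by one element over `ℚ_[p]`, there is a non-trivial element of norm `1`
of finite order prime to `p`. -/
theorem exists_norm_eq_one_pow_eq_one (hD : ∀ x : D, Algebra.adjoin ℚ_[p] {x} ≠ ⊤) :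
    ∃ (m : ℕ) (g : D), ¬ p ∣ m ∧ g ^ m = 1 ∧ g ≠ 1 ∧ Algebra.norm ℚ_[p] g = 1 := by
  have : ProperSpace D := FiniteDimensional.proper ℚ_[p] D
  have hpD : ‖(p : D)‖ < 1 := by
    rw [← map_natCast (algebraMap ℚ_[p] D), norm_algebraMap']
    exact Padic.norm_p_lt_one
  obtain ⟨x, hx, hx'⟩ := exists_norm_sub_algebraMap_ge (K := ℚ_[p]) hD
  have hx1 : ‖x‖ = 1 := le_antisymm hx (by simpa using hx' 0)
  obtain ⟨m, w, hm, hw, hwx⟩ := exists_pow_eq_one_norm_sub_lt hpD hx1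
  have hm0 : m ≠ 0 := by rintro rfl; exact hm (dvd_zero p)
  have hw1 : ‖w‖ = 1 := by
    have := congrArg norm hw
    rw [norm_pow, norm_one] at this
    exact (pow_eq_one_iff_of_nonneg (norm_nonneg _) hm0).mp this
  have hw' : ∀ n : ℤ, 1 ≤ ‖w - n‖ := fun n => by
    by_contra! hlt
    have h1 : x - algebraMap ℚ_[p] D n = (w - n) - (w - x) := by
      rw [map_intCast]
      abel
    have h2 := hx' n
    rw [h1] at h2
    exact absurd ((norm_sub_le_max _ _).trans_lt (max_lt hlt hwx)) h2.not_gt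
  -- The exponent kills the norm of `w`, a root of unity in `ℚ_[p]`, but not `w`, whose residue lies
  -- outside the prime field.
  refine ⟨m, w ^ (p - 1), hm, by rw [pow_right_comm, hw, one_pow], fun h => ?_, ?_⟩
  · have h1 := one_le_norm_pow_prime_sub_self hpD hw1.le hw'
    have hp0 : p ≠ 0 := (Fact.out : p.Prime).ne_zero
    have h2 : w ^ p = w := by
      have h3 : p = p - 1 + 1 := by omega
      conv_lhs => rw [h3]
      rw [pow_succ, h, one_mul]
    rw [h2, sub_self, norm_zero] at h1
    norm_num at h1
  · rw [map_pow]
    exact Padic.pow_sub_one_eq_one_of_pow_eq_one hm (by rw [← map_pow, hw, map_one])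

end Main

end Torsion

/-! ### Lie groups of units of a normed division algebra -/

section LieGroup

variable {K : Type u} {D : Type v} [NontriviallyNormedField K] [CompleteSpace K]
  [NormedDivisionRing D] [NormedAlgebra K D] [CompleteSpace D]

omit [CompleteSpace K] [CompleteSpace D] in
/-- A group of units of `D` is a Lie group if it has charts that extend to analytic maps on `D` and
whose inverses are analytic as maps to `D`. -/
theorem exists_lieGroup_of_charts {E : Type*} [NormedAddCommGroup E] [NormedSpace K E]
    (G : Subgroup Dˣ) (e : G → OpenPartialHomeomorph G E) (he : ∀ g, g ∈ (e g).source)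
    (A : G → D →L[K] E) (hA : ∀ g x, e g x = A g ((x : Dˣ) : D))
    (hsymm : ∀ g, ContDiffOn K ω (fun y => (((e g).symm y : Dˣ) : D)) (e g).target) :
    ∃ _ : ChartedSpace E G, LieGroup 𝓘(K, E) ω G := by
  let cs : ChartedSpace E G :=
    { atlas := Set.range e
      chartAt := e
      mem_chart_source := he
      chart_mem_atlas := fun g => ⟨g, rfl⟩ }
  have hman : IsManifold 𝓘(K, E) ω G := by
    refine isManifold_of_contDiffOn _ _ _ ?_
    rintro _ _ ⟨g, rfl⟩ ⟨g', rfl⟩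
    have h1 : ContDiffOn K ω (fun y => A g' (((e g).symm y : Dˣ) : D)) (e g).target :=
      (A g').contDiff.comp_contDiffOn (hsymm g)
    refine (h1.mono ?_).congr ?_
    · rintro y ⟨hy, -⟩
      exact hy.1
    · intro y _
      exact hA g' _
  have hval : ContMDiff 𝓘(K, E) 𝓘(K, D) ω (fun x : G => ((x : Dˣ) : D)) := by
    rw [contMDiff_iff]
    refine ⟨Units.continuous_val.comp continuous_subtype_val, fun g y => ?_⟩
    refine ((hsymm g).mono ?_).congr ?_
    · rintro y ⟨hy, -⟩
      simp only [extChartAt, OpenPartialHomeomorph.extend, mfld_simps] at hy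
      exact hy
    · intro y _
      rfl
  -- A continuous map to `G` is analytic once it is so as a map to `D`, because the charts are
  -- restrictions of linear maps.
  have hlift : ∀ {E' H' M : Type _} [NormedAddCommGroup E'] [NormedSpace K E']
      [TopologicalSpace H'] (I : ModelWithCorners K E' H') [TopologicalSpace M]
      [ChartedSpace H' M] [IsManifold I ω M] (f : M → G), Continuous f →
      ContMDiff I 𝓘(K, D) ω (fun x => ((f x : Dˣ) : D)) → ContMDiff I 𝓘(K, E) ω f := by
    intro E' H' M _ _ _ I _ _ _ f hf h
    rw [contMDiff_iff_target]
    refine ⟨hf, fun g => ?_⟩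
    refine (((A g).contDiff.contMDiff.comp h).contMDiffOn).congr fun x _ => ?_
    exact hA g (f x)
  refine ⟨cs, { hman with contMDiff_mul := ?_, contMDiff_inv := ?_ }⟩
  · refine hlift _ _ continuous_mul ?_
    have h1 := (contDiff_mul (𝕜 := K) (𝔸 := D) (n := ω)).contMDiff.comp
      ((hval.comp contMDiff_fst).prodMk_space (hval.comp (contMDiff_snd (M := G) (N := G))))
    exact h1
  · refine hlift _ _ continuous_inv fun x => ?_
    have h1 : ContDiffAt K ω Ring.inverse (((x : Dˣ) : D)) := contDiffAt_ringInverse K (x : Dˣ)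
    refine (h1.contMDiffAt.comp x (hval x)).congr_of_eventuallyEq (.of_forall fun y => ?_)
    simp

omit [CompleteSpace D] in
theorem contDiff_algebraNorm [FiniteDimensional K D] :
    ContDiff K ω fun x : D => Algebra.norm K x := by
  let b := Module.finBasis K D
  have h : (fun x : D => Algebra.norm K x) =
      fun x => (Algebra.leftMulMatrix b x).det := by
    ext x
    exact Algebra.norm_eq_matrix_det b _
  rw [h]
  simp only [Matrix.det_apply']
  refine ContDiff.sum fun σ _ => contDiff_const.mul (contDiff_prod fun i _ => ?_)
  exact (LinearMap.toContinuousLinearMap ((Matrix.entryLinearMap K K (σ i) i).comp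
    (Algebra.leftMulMatrix b).toLinearMap)).contDiff

omit [CompleteSpace D] in
-- On the line of scalars the norm is `t ↦ t ^ d`. In characteristic zero its derivative at `1` is
-- therefore non-zero.
theorem fderiv_algebraNorm_one [FiniteDimensional K D] :
    fderiv K (fun x : D => Algebra.norm K x) 1 1 = Module.finrank K D := by
  have h1 : HasDerivAt (fun t : K => algebraMap K D t) (1 : D) 1 := by
    have h := (Algebra.linearMap K D).toContinuousLinearMap.hasDerivAt (x := (1 : K))
    rw [LinearMap.coe_toContinuousLinearMap', Algebra.linearMap_apply, map_one] at h
    exact h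
  have h2 : HasFDerivAt (fun x : D => Algebra.norm K x)
      (fderiv K (fun x : D => Algebra.norm K x) 1) (algebraMap K D 1) := by
    rw [map_one]
    exact (contDiff_algebraNorm.differentiable (by simp) 1).hasFDerivAt
  have h3 := h2.comp_hasDerivAt (1 : K) h1
  have h4 : HasDerivAt (fun t : K => t ^ Module.finrank K D) (Module.finrank K D : K) 1 := by
    simpa using hasDerivAt_pow (Module.finrank K D) (1 : K)
  refine h3.unique (h4.congr_of_eventuallyEq (.of_forall fun t => ?_))
  exact Algebra.norm_algebraMap t

/-- Near `1`, the norm is a coordinate of an analytic chart whose other coordinates are linear. -/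
theorem exists_chart_algebraNorm [FiniteDimensional K D] [CharZero K] :
    ∃ (d : ℕ) (P : D →L[K] (Fin d → K)) (Φ : OpenPartialHomeomorph D ((Fin d → K) × K)),
      (∀ x, Φ x = (P x, Algebra.norm K x)) ∧ 1 ∈ Φ.source ∧ ContDiffOn K ω Φ.symm Φ.target := by
  -- The line `K • 1` is transverse to the fibre of the norm, so coordinates on `D ⧸ S` parametrize
  -- the fibre near `1`.
  let S : Submodule K D := K ∙ (1 : D)
  let d := Module.finrank K (D ⧸ S)
  let P : D →L[K] (Fin d → K) := LinearMap.toContinuousLinearMap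
    ((Module.finBasis K (D ⧸ S)).equivFun.toLinearMap ∘ₗ S.mkQ)
  have hP : ∀ x, P x = 0 → ∃ c : K, c • (1 : D) = x := fun x hx => by
    have h1 : (Module.finBasis K (D ⧸ S)).equivFun (S.mkQ x) = 0 := hx
    rw [LinearEquiv.map_eq_zero_iff, ← LinearMap.mem_ker, Submodule.ker_mkQ] at h1
    exact Submodule.mem_span_singleton.mp h1
  have hP1 : P 1 = 0 := by
    change (Module.finBasis K (D ⧸ S)).equivFun (S.mkQ 1) = 0
    rw [LinearEquiv.map_eq_zero_iff, ← LinearMap.mem_ker, Submodule.ker_mkQ]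
    exact Submodule.mem_span_singleton_self 1
  let F : D → (Fin d → K) × K := fun x => (P x, Algebra.norm K x)
  have hF : ContDiff K ω F := P.contDiff.prodMk contDiff_algebraNorm
  let N' := fderiv K (fun x : D => Algebra.norm K x) 1
  let F' : D →L[K] (Fin d → K) × K := P.prod N'
  have hker : Function.Injective F' := by
    rw [injective_iff_map_eq_zero]
    intro x hx
    obtain ⟨h1, h2⟩ := Prod.mk.inj hx
    obtain ⟨c, rfl⟩ := hP x h1
    have h3 : c * (Module.finrank K D : K) = 0 := by
      have h4 : N' (c • (1 : D)) = 0 := h2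
      rwa [map_smul, smul_eq_mul, fderiv_algebraNorm_one] at h4
    rw [(mul_eq_zero.mp h3).resolve_right (Nat.cast_ne_zero.mpr Module.finrank_pos.ne'), zero_smul]
  have hdim : Module.finrank K D = Module.finrank K ((Fin d → K) × K) := by
    rw [Module.finrank_prod, Module.finrank_fin_fun, Module.finrank_self,
      ← S.finrank_quotient_add_finrank, finrank_span_singleton one_ne_zero]
  let L : D ≃L[K] (Fin d → K) × K :=
    (LinearMap.linearEquivOfInjective F'.toLinearMap hker hdim).toContinuousLinearEquiv
  have hL : (L : D →L[K] (Fin d → K) × K) = F' := by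
    ext x
    all_goals rfl
  have hstrict : HasStrictFDerivAt F (L : D →L[K] (Fin d → K) × K) 1 := by
    rw [hL]
    exact P.hasStrictFDerivAt.prodMk
      ((contDiff_algebraNorm (K := K) (D := D)).contDiffAt.analyticAt.hasStrictFDerivAt)
  let Φ₀ := hstrict.toOpenPartialHomeomorph F
  have h1 : (1 : D) ∈ Φ₀.source := hstrict.mem_toOpenPartialHomeomorph_source
  have hsymm : AnalyticAt K Φ₀.symm (F 1) :=
    Φ₀.analyticAt_symm' h1 (hF.contDiffAt.analyticAt) hstrict.hasFDerivAt.fderiv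
  -- The target is shrunk to the open set where the inverse is analytic.
  let Φ := (Φ₀.symm.restrOpen {y | AnalyticAt K Φ₀.symm y} (isOpen_analyticAt K _)).symm
  refine ⟨d, P, Φ, fun x => rfl, ?_, ?_⟩
  · exact ⟨h1, hsymm⟩
  · intro y hy
    have h2 : AnalyticAt K Φ₀.symm y := hy.2
    exact h2.contDiffAt.contDiffWithinAt

theorem exists_lieGroup_norm_one [FiniteDimensional K D] [CharZero K] (G : Subgroup Dˣ)
    (hG : ∀ x : Dˣ, x ∈ G ↔ Algebra.norm K (x : D) = 1) :
    ∃ (d : ℕ) (_ : ChartedSpace (Fin d → K) G), LieGroup 𝓘(K, Fin d → K) ω G := by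
  classical
  obtain ⟨d, P, Φ, hΦ, h1, hsymm⟩ := exists_chart_algebraNorm (K := K) (D := D)
  refine ⟨d, ?_⟩
  have hemb : Topology.IsEmbedding fun g : G => ((g : Dˣ) : D) :=
    Units.isEmbedding_val₀.comp Topology.IsEmbedding.subtypeVal
  have hinv : ∀ y, (y, 1) ∈ Φ.target → ∃ g : G, ((g : Dˣ) : D) = Φ.symm (y, 1) := by
    intro y hy
    have h2 : Algebra.norm K (Φ.symm (y, 1)) = 1 := by
      have := congrArg Prod.snd (Φ.right_inv hy)
      rwa [hΦ] at this
    have h3 : Φ.symm (y, 1) ≠ 0 := fun h => by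
      rw [h, Algebra.norm_zero] at h2
      exact zero_ne_one h2
    exact ⟨⟨Units.mk0 _ h3, (hG _).mpr h2⟩, rfl⟩
  -- The slice of the inverse chart at norm `1`; the value `1` off the target is arbitrary.
  let inv : (Fin d → K) → G := fun y => if hy : (y, 1) ∈ Φ.target then (hinv y hy).choose else 1
  have hinv' : ∀ y, (y, 1) ∈ Φ.target → ((inv y : Dˣ) : D) = Φ.symm (y, 1) := fun y hy => by
    simp only [inv, dif_pos hy]
    exact (hinv y hy).choose_spec
  have hΦG : ∀ g : G, Φ ((g : Dˣ) : D) = (P ((g : Dˣ) : D), 1) := fun g => by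
    rw [hΦ, (hG g).mp g.2]
  have hcont : ContDiffOn K ω (fun y => ((inv y : Dˣ) : D)) {y | (y, 1) ∈ Φ.target} := by
    refine ContDiffOn.congr ?_ hinv'
    exact hsymm.comp (contDiff_prodMk_left 1).contDiffOn fun y hy => hy
  let e₁ : OpenPartialHomeomorph G (Fin d → K) :=
    { toFun := fun g => P ((g : Dˣ) : D)
      invFun := inv
      source := {g | ((g : Dˣ) : D) ∈ Φ.source}
      target := {y | (y, 1) ∈ Φ.target}
      map_source' := fun g hg => by
        have := Φ.map_source hg
        rwa [hΦG] at this
      map_target' := fun y hy => by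
        change ((inv y : Dˣ) : D) ∈ Φ.source
        rw [hinv' y hy]
        exact Φ.map_target hy
      left_inv' := fun g hg => by
        have h2 : (P ((g : Dˣ) : D), 1) ∈ Φ.target := hΦG g ▸ Φ.map_source hg
        apply hemb.injective
        change ((inv _ : Dˣ) : D) = _
        rw [hinv' _ h2, ← hΦG, Φ.left_inv hg]
      right_inv' := fun y hy => by
        have h2 := congrArg Prod.fst (Φ.right_inv hy)
        rw [hΦ, ← hinv' y hy] at h2
        exact h2
      open_source := Φ.open_source.preimage hemb.continuous
      open_target := Φ.open_target.preimage (by fun_prop)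
      continuousOn_toFun := (P.continuous.comp hemb.continuous).continuousOn
      continuousOn_invFun := hemb.continuousOn_iff.mpr hcont.continuousOn }
  let e : G → OpenPartialHomeomorph G (Fin d → K) := fun g =>
    (Homeomorph.mulLeft g⁻¹).toOpenPartialHomeomorph.trans e₁
  refine exists_lieGroup_of_charts G e (fun g => ?_)
    (fun g => P.comp (ContinuousLinearMap.mul K D (((g⁻¹ : G) : Dˣ) : D))) (fun g x => ?_)
    (fun g => ?_)
  · simp [e, e₁, h1]
  · rfl
  · have h2 : ContDiffOn K ω (fun y => ((g : Dˣ) : D) * ((inv y : Dˣ) : D))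
        {y | (y, 1) ∈ Φ.target} := contDiffOn_const.mul hcont
    refine (h2.mono ?_).congr ?_
    · intro y hy
      exact hy.1
    · intro y _
      have : (e g).symm y = g * inv y := by
        change g⁻¹⁻¹ * inv y = _
        rw [inv_inv]
      rw [this]
      rfl

end LieGroup

/-- The theorem for a division algebra whose topology is given by a multiplicative norm. -/
theorem SLOne_properties_of_normedDivisionRing (p : ℕ) [Fact p.Prime] (ℓ : ℕ) (hℓ : ℓ.Prime)
    (D : Type u) [NormedDivisionRing D] [NormedAlgebra ℚ_[p] D] [IsUltrametricDist D]
    [Algebra.IsCentral ℚ_[p] D]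
    (hD : Module.finrank ℚ_[p] D = ℓ ^ 2) (hp : Odd p) (hℓp : ¬ ℓ ∣ p - 1)
    (hnorm : ∀ x : D, Algebra.norm ℚ_[p] x = 1 → ‖x‖ = 1) :
    IsProfiniteGroup (SLOne ℚ_[p] D) ∧
      IsPadicAnalyticGroup p (SLOne ℚ_[p] D) ∧
      IsCSAGroup (SLOne ℚ_[p] D) ∧
      ¬ IsProPGroup p (SLOne ℚ_[p] D) ∧
      ¬ (∀ x y : SLOne ℚ_[p] D, x * y = y * x) := by
  have hfin : FiniteDimensional ℚ_[p] D := Module.finite_of_finrank_pos (hD ▸ pow_pos hℓ.pos 2)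
  have : ProperSpace D := FiniteDimensional.proper ℚ_[p] D
  have hK : ∀ c : ℚ_[p], c ^ ℓ = 1 → c = 1 := fun c => Padic.eq_one_of_pow_prime_eq_one hp hℓ hℓp
  have hmem := mem_SLOne_iff_norm_eq_one (D := D) hℓ hD hK
  have hprof : IsProfiniteGroup (SLOne ℚ_[p] D) := by
    refine isProfiniteGroup_of_range_val _ ?_ fun g hg => (hnorm _ ((hmem g).mp hg)).le
    have hset : {x : D | ∃ g ∈ SLOne ℚ_[p] D, (g : D) = x} = {x : D | Algebra.norm ℚ_[p] x = 1} := by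
      ext x
      constructor
      · rintro ⟨g, hg, rfl⟩
        exact (hmem g).mp hg
      · intro hx
        have hx0 : x ≠ 0 := by
          rintro rfl
          exact zero_ne_one (Algebra.norm_zero.symm.trans hx)
        exact ⟨Units.mk0 x hx0, (hmem _).mpr hx, rfl⟩
    rw [hset]
    exact isClosed_eq (continuous_algebraNorm ℚ_[p] D) continuous_const
  refine ⟨hprof, ⟨hprof.isTopologicalGroup, exists_lieGroup_norm_one _ hmem⟩,
    isCSAGroup_SLOne hℓ hD hK, ?_, not_commutative_SLOne hℓ hD hK⟩
  -- A generator of `D` would be central, making `D` commutative.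
  have hgen : ∀ x : D, Algebra.adjoin ℚ_[p] {x} ≠ ⊤ := by
    intro x hx
    have h1 := mem_bot_of_centralizer_eq_top (top_le_iff.mp (hx ▸ adjoin_le_centralizer x))
    obtain ⟨a, b, hab⟩ := exists_not_commute hℓ hD
    have h2 : a ∈ (⊥ : Subalgebra ℚ_[p] D) := by
      have h3 : Algebra.adjoin ℚ_[p] {x} ≤ ⊥ := Algebra.adjoin_le (Set.singleton_subset_iff.mpr h1)
      exact h3 (hx ▸ Algebra.mem_top)
    obtain ⟨c, rfl⟩ := Algebra.mem_bot.mp h2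
    exact hab (Algebra.commutes c b)
  obtain ⟨m, g, hm, hgm, hg1, hg⟩ := exists_norm_eq_one_pow_eq_one hgen
  have hg0 : g ≠ 0 := by
    rintro rfl
    exact zero_ne_one (Algebra.norm_zero.symm.trans hg)
  let g' : SLOne ℚ_[p] D := ⟨Units.mk0 g hg0, (hmem _).mpr hg⟩
  refine not_isProPGroup_of_pow_eq_one Fact.out (g := g') (fun h => hg1 ?_) hm ?_
  · exact congrArg (fun t : SLOne ℚ_[p] D => ((t : Dˣ) : D)) h
  · exact Subtype.ext (Units.ext hgm)

theorem theoremt (p : ℕ) [Fact p.Prime] (ℓ : ℕ) (hℓ : ℓ.Prime)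
    (D : Type u) [DivisionRing D] [Algebra ℚ_[p] D] [Algebra.IsCentral ℚ_[p] D]
    (hD : Module.finrank ℚ_[p] D = ℓ ^ 2)
    [TopologicalSpace D] [IsModuleTopology ℚ_[p] D]
    (hp : Odd p) (hℓp : ¬ ℓ ∣ p - 1) :
    IsProfiniteGroup (SLOne ℚ_[p] D) ∧
      IsPadicAnalyticGroup p (SLOne ℚ_[p] D) ∧
      IsCSAGroup (SLOne ℚ_[p] D) ∧
      ¬ IsProPGroup p (SLOne ℚ_[p] D) ∧
      ¬ (∀ x y : SLOne ℚ_[p] D, x * y = y * x) := by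
  have : FiniteDimensional ℚ_[p] D := Module.finite_of_finrank_pos (hD ▸ pow_pos hℓ.pos 2)
  rename_i t _
  -- The given topology is replaced by that of the absolute value, so that the normed version
  -- applies verbatim.
  obtain rfl := topology_eq_div ℚ_[p] D (t := t)
  exact @SLOne_properties_of_normedDivisionRing p _ ℓ hℓ D (divNormedDivisionRing ℚ_[p] D) (divNormedAlgebra ℚ_[p] D)
    (isUltrametricDist_div ℚ_[p] D) _ hD hp hℓp
    (fun x hx => divAbs_eq_one_of_norm_eq_one ℚ_[p] hx)
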